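/- Let $V$ be a finite-dimensional real normed space, let $1\le p<2$ and $a\le b\le c$ be real numbers. For $s\le t$ let $C_p([s,t],V)$ be the set of continuous paths $x:[s,t]\to V$ of finite $p$-variation, i.e. with $$\sup_{s=t_0<t_1<\dots<t_n=t}\ \sum_{i=0}^{n-1}\|x_{t_{i+1}}-x_{t_i}\|^p<\infty .$$ Integrals $\int f\,dx$ are Young integrals, i.e. limits of the Riemann–Stieltjes sums $\sum_i f_{\tau_i}(x_{t_{i+1}}-x_{t_i})$, with arbitrary tags $\tau_i\in[t_i,t_{i+1}]$, as the mesh of the partition tends to $0$. For a path $x$ on an interval containing $[s,t]$, its signature on $[s,t]$ is $$S(x)_{[s,t]}=\bigl(1,S(x)^{(1)}_{[s,t]},S(x)^{(2)}_{[s,t]},\dots\bigr)\in T((V))=\prod_{k\ge0}V^{\otimes k},$$ where $S(x)^{(k)}_{[s,t]}=\int_{s<t_1<\dots<t_k<t}dx_{t_1}\otimes\cdots\otimes dx_{t_k}$ is the iterated Young integral given by $S(x)^{(0)}_{[s,t]}=1$ and $S(x)^{(k+1)}_{[s,t]}=\int_s^t S(x)^{(k)}_{[s,u]}\otimes dx_u$.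 The product of $T((V))$ is $(v\cdot w)_n=\sum_{l=0}^n v_l\otimes w_{n-l}$. (Chen's relation) Let $x\in C_p([a,b],V)$ and $y\in C_p([b,c],V)$, and let $x*y$ be their concatenation, $(x*y)_t=x_t$ for $t\in[a,b]$ and $(x*y)_t=y_t-y_b+x_b$ for $t\in[b,c]$. Then $x*y\in C_p([a,c],V)$, all the Young integrals in the definition of the signatures of $x$ on $[a,t]$ ($t\in[a,b]$), of $y$ on $[b,t]$ ($t\in[b,c]$) and of $x*y$ on $[a,t]$ ($t\in[a,c]$) exist and are unique, and $$S(x*y)_{[a,c]}=S(x)_{[a,b]}\cdot S(y)_{[b,c]}.$$ -/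

import Mathlib

open scoped TensorProduct ENNReal

noncomputable section

/-! ### Partitions, `p`-variation, and the path spaces `C_p([a,b],V)`

A path `[a,b] → V` is represented by a function `ℝ → V`; every notion below uses only its values
on the interval under consideration. -/

/-- A partition `a = t₀ < t₁ < ... < tₙ = b` of the interval `[a,b]`.
(Only the values `pt i` with `i ≤ n` matter; for `a = b` the partition is the one with `n = 0`.) -/
structure IntervalPartition (a b : ℝ) where
  n : ℕ
  pt : ℕ → ℝ
  pt_lt : ∀ i < n, pt i < pt (i + 1)
  pt_zero : pt 0 = a
  pt_last : pt n = b

/-- The `p`-variation of `x` over `[s,t]`, as an extended nonnegative real number. -/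
def pVariation {V : Type*} [NormedAddCommGroup V] (p : ℝ) (x : ℝ → V) (s t : ℝ) : ℝ≥0∞ :=
  (⨆ P : IntervalPartition s t,
    ∑ i ∈ Finset.range P.n, ‖x (P.pt (i + 1)) - x (P.pt i)‖ₑ ^ p) ^ (1 / p)

/-- `C_p([a,b],V)`: continuous paths on `[a,b]` with finite `p`-variation. -/
def pVarPaths (V : Type*) [NormedAddCommGroup V] (p a b : ℝ) : Set (ℝ → V) :=
  {x | ContinuousOn x (Set.Icc a b) ∧ pVariation p x a b < ∞}

/-- The concatenation `x * y` of a path `x` on `[a,b]` and a path `y` on `[b,c]`. -/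
def concatPath {V : Type*} [NormedAddCommGroup V] (b : ℝ) (x y : ℝ → V) : ℝ → V :=
  fun t => if t ≤ b then x t else y t - y b + x b

/-! ### Young integration -/

/-- `I` is the Young integral `∫_a^b f dx`: the limit, as the mesh tends to zero, of all
Riemann-Stieltjes sums `∑ f(τᵢ) (x(tᵢ₊₁) - x(tᵢ))` with tags `τᵢ ∈ [tᵢ, tᵢ₊₁]`. -/
def HasYoungIntegral {V W : Type*} [NormedAddCommGroup V] [NormedSpace ℝ V]
    [SeminormedAddCommGroup W] [NormedSpace ℝ W]
    (f : ℝ → V →ₗ[ℝ] W) (x : ℝ → V) (a b : ℝ) (I : W) : Prop :=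
  ∀ ε > 0, ∃ δ > 0, ∀ (P : IntervalPartition a b) (τ : ℕ → ℝ),
    (∀ i < P.n, P.pt (i + 1) - P.pt i < δ) →
    (∀ i < P.n, τ i ∈ Set.Icc (P.pt i) (P.pt (i + 1))) →
    ‖(∑ i ∈ Finset.range P.n, f (τ i) (x (P.pt (i + 1)) - x (P.pt i))) - I‖ < ε

open Classical in
/-- The Young integral `∫_a^b f dx` (with value `0` if it does not exist). -/
def youngIntegral {V W : Type*} [NormedAddCommGroup V] [NormedSpace ℝ V]
    [SeminormedAddCommGroup W] [NormedSpace ℝ W]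
    (f : ℝ → V →ₗ[ℝ] W) (x : ℝ → V) (a b : ℝ) : W :=
  if h : ∃ I, HasYoungIntegral f x a b I then h.choose else 0

/-! ### The algebra `T((V))` of formal tensor series -/

/-- `T((V))`, the product over all `k` of the tensor powers of `V`. -/
def TensorSeries (V : Type*) [AddCommGroup V] [Module ℝ V] : Type _ :=
  ∀ k : ℕ, ⨂[ℝ]^k V

/-- The tensor product `(v · w)ₙ = ∑_{l ≤ n} vₗ ⊗ wₙ₋ₗ`; here `GradedMonoid.GMul.mul` is the
concatenation product of tensor powers, and `TensorPower.cast` identifies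
the tensor powers of degrees `l + (n - l)` and `n`. -/
instance TensorSeries.instMul {V : Type*} [AddCommGroup V] [Module ℝ V] : Mul (TensorSeries V) where
  mul v w := fun n => ∑ l : Fin (n + 1),
    TensorPower.cast ℝ V (Nat.add_sub_of_le (Nat.le_of_lt_succ l.isLt))
      (GradedMonoid.GMul.mul (A := fun k : ℕ => ⨂[ℝ]^k V) (v l) (w (n - l)))

/-! ### The signature -/

/-- For `s` in the `k`-th tensor power, the linear map `v ↦ s ⊗ v` into the `(k+1)`-st one. -/
def tensorRight {V : Type*} [AddCommGroup V] [Module ℝ V] {k : ℕ} (s : ⨂[ℝ]^k V) :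
    V →ₗ[ℝ] ⨂[ℝ]^(k + 1) V where
  toFun v := GradedMonoid.GMul.mul (A := fun k : ℕ => ⨂[ℝ]^k V) s
    (PiTensorProduct.tprod ℝ fun _ : Fin 1 => v)
  map_add' v w := by
    have h (u : V) : (PiTensorProduct.tprod ℝ fun _ : Fin 1 => u) =
        (PiTensorProduct.subsingletonEquiv (R := ℝ) (s := fun _ : Fin 1 => V) 0).symm u :=
      (PiTensorProduct.subsingletonEquiv_symm_apply' _ u).symm
    rw [h, h, h, map_add]
    simp only [TensorPower.gMul_eq_coe_linearMap, map_add]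
  map_smul' r v := by
    have h (u : V) : (PiTensorProduct.tprod ℝ fun _ : Fin 1 => u) =
        (PiTensorProduct.subsingletonEquiv (R := ℝ) (s := fun _ : Fin 1 => V) 0).symm u :=
      (PiTensorProduct.subsingletonEquiv_symm_apply' _ u).symm
    rw [h, h, map_smul]
    simp only [TensorPower.gMul_eq_coe_linearMap, map_smul, RingHom.id_apply]

/-- The `k`-fold iterated integral `∫_{s<t₁<...<tₖ<t} dx_{t₁} ⊗ ... ⊗ dx_{tₖ}`: it is `1` for
`k = 0`, and the `(k+1)`-fold integral is the Young integral over `u ∈ [s,t]` of the `k`-fold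
integral on `[s,u]` tensored with `dx_u`. The norm on tensor powers is Mathlib's
projective norm. -/
def iteratedIntegral {V : Type*} [NormedAddCommGroup V] [NormedSpace ℝ V] (x : ℝ → V) (s : ℝ) :
    (k : ℕ) → ℝ → ⨂[ℝ]^k V
  | 0, _ => GradedMonoid.GOne.one (A := fun k : ℕ => ⨂[ℝ]^k V)
  | k + 1, t => youngIntegral (fun u => tensorRight (iteratedIntegral x s k u)) x s t

/-- All Young integrals that enter the iterated integrals of `x` on the intervals `[a,t]`,
`t ∈ [a,b]`, exist and are uniquely determined. -/
def SignatureWellDefined {V : Type*} [NormedAddCommGroup V] [NormedSpace ℝ V]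
    (x : ℝ → V) (a b : ℝ) : Prop :=
  ∀ k : ℕ, ∀ t ∈ Set.Icc a b,
    ∃! I, HasYoungIntegral (fun u => tensorRight (iteratedIntegral x a k u)) x a t I

/-- The signature `S(x)_{[s,t]} = (1, S(x)^{(1)}, S(x)^{(2)}, ...)` in `T((V))`. -/
def signature {V : Type*} [NormedAddCommGroup V] [NormedSpace ℝ V] (x : ℝ → V) (s t : ℝ) :
    TensorSeries V :=
  fun k => iteratedIntegral x s k t

end

/-! Chen's relation is proved by induction on the degree, with the upper endpoint `t` in `[b,c]`
left free. The integral defining degree `k + 1` for `x * y` on `[a,t]` splits at `b`. The part over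
`[a,b]` is the degree `k + 1` term of `x`. On `[b,t]` the increments of `x * y` are those of `y`,
and by induction the integrand is the sum over `l ≤ k` of `S(x)^(l) ⊗ S(y)^(k-l)`. The factor
`S(x)^(l)` is constant, so it comes out of the integral by associativity of the tensor product and
leaves `S(x)^(l) ⊗ S(y)^(k+1-l)`. These are the terms `l ≤ k` of the product, and the part over
`[a,b]` is the term `l = k + 1`. This is `signature_concatPath`.

The analysis lies in the existence of the integrals. The `p`-th power of the `p`-variation is a
superadditive control `ω`, and path increments are at most `ω ^ (1/p)` with `1/p > 1/2`. If the
integrand has the same regularity, the products of increments are of order `ω ^ θ` with `θ > 1`, and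
the discrete sewing lemma `norm_sum_sub_le_of_almost_additive` compares any two fine Riemann sums
through a common refinement. Continuity of `ω` is never established: the smallness that makes the
sums Cauchy comes from the uniform continuity of `x`, at the price of a slightly smaller `θ`
(`exists_hasSmallProducts`). The Young–Loève estimate shows that the indefinite integral inherits
the exponent `1/p`, so the construction can be iterated through all degrees. -/

noncomputable section

open Filter Topology

/-! ### Partitions: juxtaposition and common refinement -/

namespace IntervalPartition

variable {s t u : ℝ}

theorem strictMonoOn (P : IntervalPartition s t) : StrictMonoOn P.pt (Set.Iic P.n) :=
  strictMonoOn_of_lt_succ Set.ordConnected_Iic fun i _ _ hi => P.pt_lt i (Nat.lt_of_succ_le hi)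

theorem monotoneOn (P : IntervalPartition s t) : MonotoneOn P.pt (Set.Iic P.n) :=
  P.strictMonoOn.monotoneOn

theorem pt_mono (P : IntervalPartition s t) {i j : ℕ} (hij : i ≤ j) (hj : j ≤ P.n) :
    P.pt i ≤ P.pt j :=
  P.monotoneOn (hij.trans hj) hj hij

theorem pt_mem (P : IntervalPartition s t) {i : ℕ} (hi : i ≤ P.n) : P.pt i ∈ Set.Icc s t := by
  have h0 := P.pt_mono (Nat.zero_le i) hi
  have h1 := P.pt_mono hi le_rfl
  rw [P.pt_zero] at h0
  rw [P.pt_last] at h1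
  exact ⟨h0, h1⟩

theorem pt_injOn (P : IntervalPartition s t) : Set.InjOn P.pt (Set.Iic P.n) :=
  P.strictMonoOn.injOn

/-- The partition of a one-point interval. -/
def single (s : ℝ) : IntervalPartition s s where
  n := 0
  pt _ := s
  pt_lt i hi := absurd hi (Nat.not_lt_zero i)
  pt_zero := rfl
  pt_last := rfl

/-- The partition of `[s,t]` into `m + 1` intervals of equal length. -/
def uniform (h : s < t) (m : ℕ) : IntervalPartition s t where
  n := m + 1
  pt i := s + i * ((t - s) / (m + 1))
  pt_lt i _ := by
    have : 0 < (t - s) / (m + 1) := div_pos (sub_pos.2 h) (by positivity)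
    push_cast
    linarith
  pt_zero := by simp
  pt_last := by
    have : (m : ℝ) + 1 ≠ 0 := by positivity
    push_cast
    field_simp
    ring

theorem exists_mesh_lt (h : s ≤ t) {δ : ℝ} (hδ : 0 < δ) :
    ∃ P : IntervalPartition s t, ∀ i < P.n, P.pt (i + 1) - P.pt i < δ := by
  rcases h.eq_or_lt with rfl | h
  · exact ⟨single s, fun i hi => absurd hi (Nat.not_lt_zero i)⟩
  · obtain ⟨m, hm⟩ := exists_nat_gt ((t - s) / δ)
    refine ⟨uniform h m, fun i _ => ?_⟩
    have hm1 : (0 : ℝ) < m + 1 := by positivity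
    have : (t - s) / (m + 1) < δ := by
      rw [div_lt_iff₀ hδ] at hm
      rw [div_lt_iff₀ hm1]
      nlinarith
    simp only [uniform]
    push_cast
    linarith

theorem nonempty (h : s ≤ t) : Nonempty (IntervalPartition s t) :=
  ⟨(exists_mesh_lt h one_pos).choose⟩

/-- Juxtaposition of two functions on `ℕ` at the index `n`. -/
def glue {α : Type*} (n : ℕ) (f g : ℕ → α) : ℕ → α :=
  fun i => if i < n then f i else g (i - n)

theorem glue_of_lt {α : Type*} {n i : ℕ} (f g : ℕ → α) (h : i < n) : glue n f g i = f i :=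
  if_pos h

theorem glue_add {α : Type*} (n i : ℕ) (f g : ℕ → α) : glue n f g (n + i) = g i := by
  simp [glue]

theorem glue_of_le {α : Type*} {n i : ℕ} {f g : ℕ → α} (hfg : f n = g 0) (h : i ≤ n) :
    glue n f g i = f i := by
  rcases h.lt_or_eq with h | rfl
  · exact glue_of_lt f g h
  · rw [hfg]
    exact glue_add i 0 f g

/-- The partition of `[s,t]` obtained from partitions of `[s,u]` and `[u,t]`. -/
def concat (P : IntervalPartition s u) (Q : IntervalPartition u t) : IntervalPartition s t where
  n := P.n + Q.n
  pt := glue P.n P.pt Q.pt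
  pt_lt i hi := by
    have hPQ : P.pt P.n = Q.pt 0 := by rw [P.pt_last, Q.pt_zero]
    rcases lt_or_ge i P.n with h | h
    · rw [glue_of_lt _ _ h, glue_of_le hPQ h]
      exact P.pt_lt i h
    · obtain ⟨j, rfl⟩ := Nat.exists_eq_add_of_le h
      rw [add_assoc, glue_add, glue_add]
      exact Q.pt_lt j (by omega)
  pt_zero := by
    rw [glue_of_le (by rw [P.pt_last, Q.pt_zero]) (Nat.zero_le _), P.pt_zero]
  pt_last := by rw [glue_add, Q.pt_last]

theorem concat_n (P : IntervalPartition s u) (Q : IntervalPartition u t) :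
    (P.concat Q).n = P.n + Q.n := rfl

theorem concat_pt_of_le (P : IntervalPartition s u) (Q : IntervalPartition u t) {i : ℕ}
    (h : i ≤ P.n) : (P.concat Q).pt i = P.pt i :=
  glue_of_le (by rw [P.pt_last, Q.pt_zero]) h

theorem concat_pt_add (P : IntervalPartition s u) (Q : IntervalPartition u t) (i : ℕ) :
    (P.concat Q).pt (P.n + i) = Q.pt i :=
  glue_add _ _ _ _

theorem sum_concat {M : Type*} [AddCommMonoid M] (P : IntervalPartition s u)
    (Q : IntervalPartition u t) (F : ℝ → ℝ → M) :
    ∑ i ∈ Finset.range (P.concat Q).n, F ((P.concat Q).pt i) ((P.concat Q).pt (i + 1)) =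
      (∑ i ∈ Finset.range P.n, F (P.pt i) (P.pt (i + 1))) +
        ∑ i ∈ Finset.range Q.n, F (Q.pt i) (Q.pt (i + 1)) := by
  rw [concat_n, Finset.sum_range_add]
  congr 1
  · refine Finset.sum_congr rfl fun i hi => ?_
    have hi := Finset.mem_range.1 hi
    rw [concat_pt_of_le _ _ hi.le, concat_pt_of_le _ _ hi]
  · refine Finset.sum_congr rfl fun i _ => ?_
    rw [add_assoc, concat_pt_add, concat_pt_add]

/-- A finite subset of `[s,t]` that contains `s` and `t` is the set of points of a partition. -/
theorem exists_of_finset (F : Finset ℝ) (hF : ∀ y ∈ F, y ∈ Set.Icc s t) (hs : s ∈ F)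
    (ht : t ∈ F) : ∃ R : IntervalPartition s t, ∀ y ∈ F, ∃ i ≤ R.n, R.pt i = y := by
  obtain ⟨m, hm⟩ : ∃ m, F.card = m + 1 :=
    Nat.exists_eq_succ_of_ne_zero (Finset.card_ne_zero_of_mem hs)
  have hmem (i) : F.orderEmbOfFin hm i ∈ F := F.orderEmbOfFin_mem hm i
  have hsurj : ∀ y ∈ F, ∃ i, F.orderEmbOfFin hm i = y := fun y hy => by
    have : y ∈ Set.range (F.orderEmbOfFin hm) := by
      rw [Finset.range_orderEmbOfFin]
      exact hy
    exact this
  -- `pt` must be total on `ℕ`, so indices beyond `m` are clamped to `m`.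
  refine ⟨⟨m, fun i => F.orderEmbOfFin hm ⟨min i m, by omega⟩, ?_, ?_, ?_⟩, ?_⟩
  · intro i hi
    refine (F.orderEmbOfFin hm).strictMono ?_
    simp only [Fin.mk_lt_mk]
    omega
  · refine le_antisymm ?_ (hF _ (hmem _)).1
    obtain ⟨i, hi⟩ := hsurj s hs
    refine le_of_le_of_eq ?_ hi
    refine (F.orderEmbOfFin hm).monotone ?_
    simp only [Fin.le_def]
    omega
  · refine le_antisymm (hF _ (hmem _)).2 ?_
    obtain ⟨i, hi⟩ := hsurj t ht
    refine hi.symm.le.trans ?_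
    refine (F.orderEmbOfFin hm).monotone ?_
    simp only [Fin.le_def]
    omega
  · intro y hy
    obtain ⟨i, hi⟩ := hsurj y hy
    refine ⟨i, Nat.lt_succ_iff.1 i.2, ?_⟩
    rw [← hi]
    exact congrArg _ (Fin.ext (min_eq_left (Nat.lt_succ_iff.1 i.2)))

/-- `φ` exhibits `R` as a refinement of `P`. -/
structure IsRefinement (P R : IntervalPartition s t) (φ : ℕ → ℕ) : Prop where
  le : ∀ i ≤ P.n, φ i ≤ R.n
  pt : ∀ i ≤ P.n, R.pt (φ i) = P.pt i

theorem IsRefinement.mono {P R : IntervalPartition s t} {φ : ℕ → ℕ} (h : IsRefinement P R φ)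
    {i j : ℕ} (hij : i ≤ j) (hj : j ≤ P.n) : φ i ≤ φ j := by
  have := P.pt_mono hij hj
  rw [← h.pt i (hij.trans hj), ← h.pt j hj] at this
  exact (R.strictMonoOn.le_iff_le (h.le i (hij.trans hj)) (h.le j hj)).1 this

theorem IsRefinement.zero {P R : IntervalPartition s t} {φ : ℕ → ℕ} (h : IsRefinement P R φ) :
    φ 0 = 0 := by
  refine R.pt_injOn (h.le 0 (Nat.zero_le _)) (Nat.zero_le _) ?_
  rw [h.pt 0 (Nat.zero_le _), P.pt_zero, R.pt_zero]

theorem IsRefinement.last {P R : IntervalPartition s t} {φ : ℕ → ℕ} (h : IsRefinement P R φ) :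
    φ P.n = R.n := by
  refine R.pt_injOn (h.le _ le_rfl) (Set.mem_Iic.2 le_rfl) ?_
  rw [h.pt _ le_rfl, P.pt_last, R.pt_last]

theorem exists_common_refinement (P Q : IntervalPartition s t) :
    ∃ (R : IntervalPartition s t) (φ ψ : ℕ → ℕ), IsRefinement P R φ ∧ IsRefinement Q R ψ := by
  classical
  obtain ⟨R, hR⟩ := exists_of_finset (s := s) (t := t)
    ((Finset.range (P.n + 1)).image P.pt ∪ (Finset.range (Q.n + 1)).image Q.pt)
    (by
      intro y hy
      simp only [Finset.mem_union, Finset.mem_image, Finset.mem_range] at hy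
      obtain ⟨i, hi, rfl⟩ | ⟨i, hi, rfl⟩ := hy
      · exact P.pt_mem (by omega)
      · exact Q.pt_mem (by omega))
    (by
      refine Finset.mem_union_left _ (Finset.mem_image.2 ⟨0, ?_, P.pt_zero⟩)
      simp)
    (by
      refine Finset.mem_union_left _ (Finset.mem_image.2 ⟨P.n, ?_, P.pt_last⟩)
      simp)
  -- The condition `i ≤ P.n` is put inside the existential so that `choose` yields a total index
  -- map, with junk value beyond `P.n`.
  have hP : ∀ i, ∃ j, i ≤ P.n → j ≤ R.n ∧ R.pt j = P.pt i := fun i => by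
    by_cases hi : i ≤ P.n
    · obtain ⟨j, hj⟩ := hR (P.pt i) (Finset.mem_union_left _
        (Finset.mem_image_of_mem _ (Finset.mem_range.2 (by omega))))
      exact ⟨j, fun _ => hj⟩
    · exact ⟨0, fun h => absurd h hi⟩
  have hQ : ∀ i, ∃ j, i ≤ Q.n → j ≤ R.n ∧ R.pt j = Q.pt i := fun i => by
    by_cases hi : i ≤ Q.n
    · obtain ⟨j, hj⟩ := hR (Q.pt i) (Finset.mem_union_right _
        (Finset.mem_image_of_mem _ (Finset.mem_range.2 (by omega))))
      exact ⟨j, fun _ => hj⟩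
    · exact ⟨0, fun h => absurd h hi⟩
  choose φ hφ using hP
  choose ψ hψ using hQ
  exact ⟨R, φ, ψ, ⟨fun i hi => (hφ i hi).1, fun i hi => (hφ i hi).2⟩,
    ⟨fun i hi => (hψ i hi).1, fun i hi => (hψ i hi).2⟩⟩

end IntervalPartition

/-! ### Riemann–Stieltjes sums and their limit -/

section Young

variable {V W W' : Type*} [NormedAddCommGroup V] [NormedSpace ℝ V]
  [SeminormedAddCommGroup W] [NormedSpace ℝ W] [SeminormedAddCommGroup W'] [NormedSpace ℝ W']

/-- `τ` is a system of tags for the partition `P`, whose mesh is less than `δ`. -/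
def IsFineTagged {s t : ℝ} (δ : ℝ) (P : IntervalPartition s t) (τ : ℕ → ℝ) : Prop :=
  (∀ i < P.n, P.pt (i + 1) - P.pt i < δ) ∧
    ∀ i < P.n, τ i ∈ Set.Icc (P.pt i) (P.pt (i + 1))

theorem isFineTagged_left {s t δ : ℝ} {P : IntervalPartition s t}
    (h : ∀ i < P.n, P.pt (i + 1) - P.pt i < δ) : IsFineTagged δ P P.pt :=
  ⟨h, fun i hi => ⟨le_rfl, (P.pt_lt i hi).le⟩⟩

/-- The filter of tagged partitions of `[s,t]` whose mesh tends to zero. -/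
def youngFilter (s t : ℝ) : Filter (IntervalPartition s t × (ℕ → ℝ)) :=
  ⨅ δ ∈ Set.Ioi (0 : ℝ), 𝓟 {Q | IsFineTagged δ Q.1 Q.2}

theorem hasBasis_youngFilter (s t : ℝ) :
    (youngFilter s t).HasBasis (fun δ : ℝ => 0 < δ) fun δ => {Q | IsFineTagged δ Q.1 Q.2} := by
  refine hasBasis_biInf_principal (fun δ hδ δ' hδ' => ⟨min δ δ', Set.mem_Ioi.2 (lt_min hδ hδ'), ?_, ?_⟩) ⟨1, Set.mem_Ioi.2 one_pos⟩
  · exact fun Q hQ => ⟨fun i hi => (hQ.1 i hi).trans_le (min_le_left _ _), hQ.2⟩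
  · exact fun Q hQ => ⟨fun i hi => (hQ.1 i hi).trans_le (min_le_right _ _), hQ.2⟩

theorem youngFilter_neBot {s t : ℝ} (h : s ≤ t) : (youngFilter s t).NeBot := by
  refine (hasBasis_youngFilter s t).neBot_iff.2 fun {δ} hδ => ?_
  obtain ⟨P, hP⟩ := IntervalPartition.exists_mesh_lt h hδ
  exact ⟨(P, P.pt), isFineTagged_left hP⟩

/-- The Riemann–Stieltjes sum of `f` against `x` along a tagged partition. -/
def youngSum {s t : ℝ} (f : ℝ → V →ₗ[ℝ] W) (x : ℝ → V) (Q : IntervalPartition s t × (ℕ → ℝ)) : W :=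
  ∑ i ∈ Finset.range Q.1.n, f (Q.2 i) (x (Q.1.pt (i + 1)) - x (Q.1.pt i))

/-- Through this reformulation uniqueness, linearity and the Cauchy criterion become general facts
about limits along a filter. -/
theorem hasYoungIntegral_iff_tendsto {f : ℝ → V →ₗ[ℝ] W} {x : ℝ → V} {s t : ℝ} {I : W} :
    HasYoungIntegral f x s t I ↔ Tendsto (youngSum f x) (youngFilter s t) (𝓝 I) := by
  rw [(hasBasis_youngFilter s t).tendsto_iff Metric.nhds_basis_ball]
  simp only [HasYoungIntegral, youngSum, IsFineTagged, Metric.mem_ball, dist_eq_norm,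
    Set.mem_ofPred_eq, Prod.forall, and_imp, gt_iff_lt]

/-- Only increments of the paths are compared, because on `[b,c]` the concatenation differs from `y`
by a constant. -/
theorem youngSum_congr {f g : ℝ → V →ₗ[ℝ] W} {x y : ℝ → V} {s t δ : ℝ}
    (hfg : ∀ u ∈ Set.Icc s t, f u = g u)
    (hxy : ∀ u ∈ Set.Icc s t, ∀ v ∈ Set.Icc s t, x v - x u = y v - y u)
    {Q : IntervalPartition s t × (ℕ → ℝ)} (hQ : IsFineTagged δ Q.1 Q.2) :
    youngSum f x Q = youngSum g y Q := by
  refine Finset.sum_congr rfl fun i hi => ?_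
  have hi := Finset.mem_range.1 hi
  have h0 := Q.1.pt_mem hi.le
  have h1 := Q.1.pt_mem (show i + 1 ≤ Q.1.n from hi)
  have h2 := hQ.2 i hi
  rw [hfg _ ⟨h0.1.trans h2.1, h2.2.trans h1.2⟩, hxy _ h0 _ h1]

theorem hasYoungIntegral_congr {f g : ℝ → V →ₗ[ℝ] W} {x y : ℝ → V} {s t : ℝ} {I : W}
    (hfg : ∀ u ∈ Set.Icc s t, f u = g u)
    (hxy : ∀ u ∈ Set.Icc s t, ∀ v ∈ Set.Icc s t, x v - x u = y v - y u) :
    HasYoungIntegral f x s t I ↔ HasYoungIntegral g y s t I := by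
  rw [hasYoungIntegral_iff_tendsto, hasYoungIntegral_iff_tendsto]
  refine tendsto_congr' ?_
  filter_upwards [(hasBasis_youngFilter s t).mem_of_mem one_pos] with Q hQ
  exact youngSum_congr hfg hxy hQ

/-- The value is picked by choice, so equality comes from equality of the predicates themselves;
neither existence nor uniqueness of the integral is needed. -/
theorem youngIntegral_congr {f g : ℝ → V →ₗ[ℝ] W} {x y : ℝ → V} {s t : ℝ}
    (hfg : ∀ u ∈ Set.Icc s t, f u = g u)
    (hxy : ∀ u ∈ Set.Icc s t, ∀ v ∈ Set.Icc s t, x v - x u = y v - y u) :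
    youngIntegral f x s t = youngIntegral g y s t := by
  have : HasYoungIntegral f x s t = HasYoungIntegral g y s t :=
    funext fun I => propext (hasYoungIntegral_congr hfg hxy)
  unfold youngIntegral
  generalize HasYoungIntegral f x s t = A at this ⊢
  subst this
  rfl

theorem HasYoungIntegral.unique [T2Space W] {f : ℝ → V →ₗ[ℝ] W} {x : ℝ → V} {s t : ℝ} {I J : W}
    (hst : s ≤ t) (hI : HasYoungIntegral f x s t I) (hJ : HasYoungIntegral f x s t J) : I = J := by
  have := youngFilter_neBot hst
  exact tendsto_nhds_unique (hasYoungIntegral_iff_tendsto.1 hI) (hasYoungIntegral_iff_tendsto.1 hJ)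

theorem hasYoungIntegral_youngIntegral {f : ℝ → V →ₗ[ℝ] W} {x : ℝ → V} {s t : ℝ}
    (h : ∃ I, HasYoungIntegral f x s t I) :
    HasYoungIntegral f x s t (youngIntegral f x s t) := by
  rw [youngIntegral, dif_pos h]
  exact h.choose_spec

theorem HasYoungIntegral.map {f : ℝ → V →ₗ[ℝ] W} {x : ℝ → V} {s t : ℝ} {I : W}
    (hI : HasYoungIntegral f x s t I) (L : W →ₗ[ℝ] W') (hL : Continuous L) :
    HasYoungIntegral (fun u => L ∘ₗ f u) x s t (L I) := by
  rw [hasYoungIntegral_iff_tendsto] at hI ⊢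
  refine ((hL.tendsto I).comp hI).congr fun Q => ?_
  simp [youngSum, map_sum]

theorem HasYoungIntegral.sum {ι : Type*} (S : Finset ι) {f : ι → ℝ → V →ₗ[ℝ] W} {x : ℝ → V}
    {s t : ℝ} {I : ι → W} (hI : ∀ j ∈ S, HasYoungIntegral (f j) x s t (I j)) :
    HasYoungIntegral (fun u => ∑ j ∈ S, f j u) x s t (∑ j ∈ S, I j) := by
  rw [hasYoungIntegral_iff_tendsto]
  refine (tendsto_finsetSum S fun j hj => hasYoungIntegral_iff_tendsto.1 (hI j hj)).congr
    fun Q => ?_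
  simp only [youngSum, LinearMap.sum_apply]
  exact Finset.sum_comm

theorem IsFineTagged.concat {s t u δ : ℝ} {P : IntervalPartition s u} {Q : IntervalPartition u t}
    {τ σ : ℕ → ℝ} (hP : IsFineTagged δ P τ) (hQ : IsFineTagged δ Q σ) :
    IsFineTagged δ (P.concat Q) (IntervalPartition.glue P.n τ σ) := by
  have key : ∀ i < (P.concat Q).n, (P.concat Q).pt (i + 1) - (P.concat Q).pt i < δ ∧
      IntervalPartition.glue P.n τ σ i ∈
        Set.Icc ((P.concat Q).pt i) ((P.concat Q).pt (i + 1)) := fun i hi => by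
    rcases lt_or_ge i P.n with h | h
    · rw [P.concat_pt_of_le Q h.le, P.concat_pt_of_le Q h, IntervalPartition.glue_of_lt _ _ h]
      exact ⟨hP.1 i h, hP.2 i h⟩
    · obtain ⟨j, rfl⟩ := Nat.exists_eq_add_of_le h
      have hj : j < Q.n := by
        rw [P.concat_n] at hi
        omega
      rw [add_assoc, P.concat_pt_add, P.concat_pt_add, IntervalPartition.glue_add]
      exact ⟨hQ.1 j hj, hQ.2 j hj⟩
  exact ⟨fun i hi => (key i hi).1, fun i hi => (key i hi).2⟩

theorem youngSum_concat {s t u : ℝ} (f : ℝ → V →ₗ[ℝ] W) (x : ℝ → V) (P : IntervalPartition s u)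
    (Q : IntervalPartition u t) (τ σ : ℕ → ℝ) :
    youngSum f x (P.concat Q, IntervalPartition.glue P.n τ σ) =
      youngSum f x (P, τ) + youngSum f x (Q, σ) := by
  simp only [youngSum]
  rw [P.concat_n, Finset.sum_range_add]
  congr 1
  · refine Finset.sum_congr rfl fun i hi => ?_
    have hi := Finset.mem_range.1 hi
    rw [P.concat_pt_of_le Q hi.le, P.concat_pt_of_le Q hi, IntervalPartition.glue_of_lt _ _ hi]
  · refine Finset.sum_congr rfl fun i _ => ?_
    rw [add_assoc, P.concat_pt_add, P.concat_pt_add, IntervalPartition.glue_add]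

/-- Juxtaposed fine tagged partitions of the two halves are fine tagged partitions of the whole.
Since the integral over `[s,t]` is assumed to exist, its value can be computed along these alone,
and no point has to be inserted into an arbitrary partition. -/
theorem HasYoungIntegral.adjacent [T2Space W] {f : ℝ → V →ₗ[ℝ] W} {x : ℝ → V} {s t u : ℝ}
    {I J K : W} (hsu : s ≤ u) (hut : u ≤ t) (hI : HasYoungIntegral f x s u I)
    (hJ : HasYoungIntegral f x u t J) (hK : HasYoungIntegral f x s t K) : K = I + J := by
  rw [hasYoungIntegral_iff_tendsto] at hI hJ hK
  have := youngFilter_neBot hsu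
  have := youngFilter_neBot hut
  have hlim : Tendsto (fun R : (IntervalPartition s u × (ℕ → ℝ)) × (IntervalPartition u t × (ℕ → ℝ))
      => ((R.1.1.concat R.2.1, IntervalPartition.glue R.1.1.n R.1.2 R.2.2) :
        IntervalPartition s t × (ℕ → ℝ))) (youngFilter s u ×ˢ youngFilter u t)
      (youngFilter s t) := by
    rw [(((hasBasis_youngFilter s u).prod (hasBasis_youngFilter u t)).tendsto_iff
      (hasBasis_youngFilter s t))]
    exact fun δ hδ => ⟨(δ, δ), ⟨hδ, hδ⟩, fun R hR => hR.1.concat hR.2⟩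
  refine tendsto_nhds_unique (hK.comp hlim) ?_
  refine ((hI.comp tendsto_fst).add (hJ.comp tendsto_snd)).congr fun R => ?_
  exact (youngSum_concat f x _ _ _ _).symm

end Young

/-! ### Sewing estimates -/

/-- `ω` is a control on `[a,b]`: a nonnegative superadditive function of intervals. -/
structure IsControl (ω : ℝ → ℝ → ℝ) (a b : ℝ) : Prop where
  nonneg : ∀ ⦃s t⦄, a ≤ s → s ≤ t → t ≤ b → 0 ≤ ω s t
  superadd : ∀ ⦃s u t⦄, a ≤ s → s ≤ u → u ≤ t → t ≤ b → ω s u + ω u t ≤ ω s t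

namespace IsControl

variable {ω : ℝ → ℝ → ℝ} {a b s t u v : ℝ}

theorem restrict (h : IsControl ω a b) (hs : a ≤ s) (ht : t ≤ b) : IsControl ω s t where
  nonneg _ _ h1 h2 h3 := h.nonneg (hs.trans h1) h2 (h3.trans ht)
  superadd _ _ _ h1 h2 h3 h4 := h.superadd (hs.trans h1) h2 h3 (h4.trans ht)

theorem mono (h : IsControl ω a b) (hs : a ≤ s) (hsu : s ≤ u) (huv : u ≤ v) (hvt : v ≤ t)
    (ht : t ≤ b) : ω u v ≤ ω s t := by
  have h1 := h.superadd hs hsu (huv.trans hvt) ht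
  have h2 := h.superadd (hs.trans hsu) huv hvt ht
  have h3 := h.nonneg hs hsu (huv.trans (hvt.trans ht))
  have h4 := h.nonneg (hs.trans (hsu.trans huv)) hvt ht
  linarith

theorem sum_le (h : IsControl ω s t) (P : IntervalPartition s t) :
    ∑ i ∈ Finset.range P.n, ω (P.pt i) (P.pt (i + 1)) ≤ ω s t := by
  have key : ∀ m ≤ P.n, ∑ i ∈ Finset.range m, ω (P.pt i) (P.pt (i + 1)) ≤ ω s (P.pt m) := by
    intro m
    induction m with
    | zero =>
      intro _
      rw [P.pt_zero]
      have h0 := P.pt_mem (Nat.zero_le _)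
      rw [P.pt_zero] at h0
      simpa using h.nonneg le_rfl le_rfl h0.2
    | succ m ih =>
      intro hm
      rw [Finset.sum_range_succ]
      have h0 := P.pt_mem (Nat.le_of_succ_le hm)
      have h1 := P.pt_mem hm
      have := h.superadd le_rfl h0.1 (P.pt_lt m hm).le h1.2
      linarith [ih (Nat.le_of_succ_le hm)]
  simpa [P.pt_last] using key P.n le_rfl

/-- For `1 ≤ θ`, the sum of the `θ`-th powers of a control along a partition is at most
its `θ`-th power. -/
theorem sum_rpow_le (h : IsControl ω s t) (P : IntervalPartition s t) {θ : ℝ} (hθ : 1 ≤ θ) :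
    ∑ i ∈ Finset.range P.n, ω (P.pt i) (P.pt (i + 1)) ^ θ ≤ ω s t ^ θ := by
  have hst : s ≤ t := by
    have h0 := P.pt_mem (Nat.zero_le _)
    exact h0.1.trans h0.2
  have hω := h.nonneg le_rfl hst le_rfl
  have hsplit : ∀ r : ℝ, 0 ≤ r → r ^ θ = r ^ (θ - 1) * r := fun r hr => by
    rcases hr.eq_or_lt with rfl | hr
    · rw [Real.zero_rpow (by linarith), mul_zero]
    · rw [← Real.rpow_add_one hr.ne', sub_add_cancel]
  calc ∑ i ∈ Finset.range P.n, ω (P.pt i) (P.pt (i + 1)) ^ θ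
      ≤ ∑ i ∈ Finset.range P.n, ω s t ^ (θ - 1) * ω (P.pt i) (P.pt (i + 1)) := by
        refine Finset.sum_le_sum fun i hi => ?_
        have hi := Finset.mem_range.1 hi
        have h0 := P.pt_mem hi.le
        have h1 := P.pt_mem (show i + 1 ≤ P.n from hi)
        have h2 := (P.pt_lt i hi).le
        have h3 := h.nonneg h0.1 h2 h1.2
        rw [hsplit _ h3]
        exact mul_le_mul_of_nonneg_right
          (Real.rpow_le_rpow h3 (h.mono le_rfl h0.1 h2 h1.2 le_rfl) (by linarith)) h3
    _ = ω s t ^ (θ - 1) * ∑ i ∈ Finset.range P.n, ω (P.pt i) (P.pt (i + 1)) := by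
        rw [Finset.mul_sum]
    _ ≤ ω s t ^ (θ - 1) * ω s t :=
        mul_le_mul_of_nonneg_left (h.sum_le P) (Real.rpow_nonneg hω _)
    _ = ω s t ^ θ := (hsplit _ hω).symm

end IsControl

/-- The constant of the sewing lemma with exponent `θ`. -/
def sewingConst (θ : ℝ) : ℝ := 2 / (1 - 2 * (1 / 2) ^ θ)

theorem sewingConst_denom_pos {θ : ℝ} (hθ : 1 < θ) : 0 < 1 - 2 * (1 / 2 : ℝ) ^ θ := by
  have : (1 / 2 : ℝ) ^ θ < (1 / 2 : ℝ) ^ (1 : ℝ) :=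
    Real.rpow_lt_rpow_of_exponent_gt (by norm_num) (by norm_num) hθ
  rw [Real.rpow_one] at this
  linarith

theorem sewingConst_nonneg {θ : ℝ} (hθ : 1 < θ) : 0 ≤ sewingConst θ :=
  div_nonneg zero_le_two (sewingConst_denom_pos hθ).le

/-- Discrete sewing lemma: a two-parameter function that is additive up to `L ω ^ θ`, `θ > 1`, is
close to its Riemann sums. -/
theorem norm_sum_sub_le_of_almost_additive {E : Type*} [SeminormedAddCommGroup E] {θ L : ℝ}
    (hθ : 1 < θ) (hL : 0 ≤ L) {N : ℕ} (A : ℕ → ℕ → E) (w : ℕ → ℕ → ℝ) (hA0 : ∀ i, A i i = 0)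
    (hw0 : ∀ i j, i ≤ j → j ≤ N → 0 ≤ w i j)
    (hw : ∀ i j k, i ≤ j → j ≤ k → k ≤ N → w i j + w j k ≤ w i k)
    (hA : ∀ i j k, i ≤ j → j ≤ k → k ≤ N → ‖A i k - A i j - A j k‖ ≤ L * w i k ^ θ)
    (m n : ℕ) (hmn : m ≤ n) (hn : n ≤ N) :
    ‖∑ i ∈ Finset.Ico m n, A i (i + 1) - A m n‖ ≤ sewingConst θ * (L * w m n ^ θ) := by
  have hθ0 : 0 ≤ θ := by linarith
  have hww : ∀ i ≤ N, w i i = 0 := fun i hi => by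
    have h1 := hw i i i le_rfl le_rfl hi
    have h2 := hw0 i i le_rfl hi
    linarith
  induction hd : n - m using Nat.strong_induction_on generalizing m n with
  | _ d ih =>
  have hmn0 := hw0 m n hmn hn
  have hpow := Real.rpow_nonneg hmn0 θ
  rcases hmn.eq_or_lt with rfl | hlt
  · simpa [hA0] using mul_nonneg (sewingConst_nonneg hθ) (mul_nonneg hL hpow)
  -- The index at which the control passes half of its total: both outer blocks carry at most half,
  -- and a single interval `[j, j + 1]` is left between them.
  obtain ⟨j, hmj, hjn, hj1, hj2⟩ : ∃ j, m ≤ j ∧ j < n ∧ w m j ≤ w m n / 2 ∧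
      w (j + 1) n ≤ w m n / 2 := by
    by_cases hall : ∀ j, m ≤ j → j < n → w m j ≤ w m n / 2
    · refine ⟨n - 1, by omega, by omega, hall _ (by omega) (by omega), ?_⟩
      rw [Nat.sub_add_cancel (by omega), hww n hn]
      linarith
    · push Not at hall
      classical
      -- For the first `k` with `w m k > w m n / 2`, superadditivity forces `w k n ≤ w m n / 2`, and
      -- `j = k - 1` works by minimality. Here `k > m` since `w m m = 0`.
      have hspec := Nat.find_spec hall
      have hmin := fun k => Nat.find_min hall (m := k)
      set k := Nat.find hall
      have hk : m < k := lt_of_le_of_ne hspec.1 fun h => by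
        have := hspec.2.2
        rw [← h, hww m (hmn.trans hn)] at this
        linarith
      refine ⟨k - 1, by omega, by omega, ?_, ?_⟩
      · by_contra hcon
        exact hmin (k - 1) (by omega) ⟨by omega, by omega, not_le.1 hcon⟩
      · rw [Nat.sub_add_cancel (by omega)]
        have := hw m k n hspec.1 hspec.2.1.le hn
        linarith [hspec.2.2]
  have e1 := ih (j - m) (by omega) m j hmj (by omega) rfl
  have e2 := ih (n - (j + 1)) (by omega) (j + 1) n hjn hn rfl
  have e3 := hA m (j + 1) n (by omega) hjn hn
  have e4 := hA m j (j + 1) hmj (by omega) (by omega)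
  have hhalf : (w m n / 2) ^ θ = (1 / 2) ^ θ * w m n ^ θ := by
    rw [← Real.mul_rpow (by norm_num) hmn0]
    congr 1
    ring
  have b1 : w m j ^ θ ≤ (1 / 2) ^ θ * w m n ^ θ :=
    hhalf ▸ Real.rpow_le_rpow (hw0 m j hmj (by omega)) hj1 hθ0
  have b2 : w (j + 1) n ^ θ ≤ (1 / 2) ^ θ * w m n ^ θ :=
    hhalf ▸ Real.rpow_le_rpow (hw0 _ _ hjn hn) hj2 hθ0
  have b4 : w m (j + 1) ^ θ ≤ w m n ^ θ := by
    refine Real.rpow_le_rpow (hw0 _ _ (by omega) (by omega)) ?_ hθ0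
    linarith [hw m (j + 1) n (by omega) hjn hn, hw0 (j + 1) n hjn hn]
  have hsum : ∑ i ∈ Finset.Ico m n, A i (i + 1) =
      ∑ i ∈ Finset.Ico m j, A i (i + 1) + A j (j + 1) +
        ∑ i ∈ Finset.Ico (j + 1) n, A i (i + 1) := by
    rw [← Finset.sum_Ico_consecutive _ (show m ≤ j + 1 by omega) hjn,
      Finset.sum_Ico_succ_top hmj]
  have hid : ∑ i ∈ Finset.Ico m n, A i (i + 1) - A m n =
      (∑ i ∈ Finset.Ico m j, A i (i + 1) - A m j) +
        (∑ i ∈ Finset.Ico (j + 1) n, A i (i + 1) - A (j + 1) n) -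
        (A m n - A m (j + 1) - A (j + 1) n) - (A m (j + 1) - A m j - A j (j + 1)) := by
    rw [hsum]
    abel
  have hK := sewingConst_nonneg hθ
  -- The equation that dictates the constant: two halves, each gaining `(1/2) ^ θ`, plus two
  -- additivity defects from cutting out the middle interval.
  have hKeq : sewingConst θ * (2 * (1 / 2) ^ θ) + 2 = sewingConst θ := by
    have := (sewingConst_denom_pos hθ).ne'
    unfold sewingConst
    field_simp
    ring
  rw [hid]
  calc _ ≤ ‖∑ i ∈ Finset.Ico m j, A i (i + 1) - A m j‖ +
        ‖∑ i ∈ Finset.Ico (j + 1) n, A i (i + 1) - A (j + 1) n‖ +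
        ‖A m n - A m (j + 1) - A (j + 1) n‖ + ‖A m (j + 1) - A m j - A j (j + 1)‖ :=
        (norm_sub_le _ _).trans (add_le_add_left ((norm_sub_le _ _).trans
          (add_le_add_left (norm_add_le _ _) _)) _)
    _ ≤ sewingConst θ * (L * ((1 / 2) ^ θ * w m n ^ θ)) +
        sewingConst θ * (L * ((1 / 2) ^ θ * w m n ^ θ)) + L * w m n ^ θ + L * w m n ^ θ := by
        gcongr
        · exact e1.trans (by gcongr)
        · exact e2.trans (by gcongr)
        · exact e4.trans (by gcongr)
    _ = (sewingConst θ * (2 * (1 / 2) ^ θ) + 2) * (L * w m n ^ θ) := by ring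
    _ = sewingConst θ * (L * w m n ^ θ) := by rw [hKeq]

/-! ### Existence of the Young integral and the Young–Loève estimate -/

section Young

variable {V W : Type*} [NormedAddCommGroup V] [NormedSpace ℝ V]
  [SeminormedAddCommGroup W] [NormedSpace ℝ W]

/-- On intervals of length less than `δ`, the products of increments of `f` and `x` are
at most `L ω ^ θ`. -/
def HasSmallProducts (f : ℝ → V →ₗ[ℝ] W) (x : ℝ → V) (ω : ℝ → ℝ → ℝ) (s t θ δ L : ℝ) : Prop :=
  ∀ ⦃u w⦄, s ≤ u → u ≤ w → w ≤ t → w - u < δ → ∀ v₁ ∈ Set.Icc u w, ∀ v₂ ∈ Set.Icc u w,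
    ∀ v₃ ∈ Set.Icc u w, ∀ v₄ ∈ Set.Icc u w, ‖(f v₁ - f v₂) (x v₃ - x v₄)‖ ≤ L * ω u w ^ θ

variable {f : ℝ → V →ₗ[ℝ] W} {x : ℝ → V} {ω : ℝ → ℝ → ℝ} {s t θ δ L : ℝ}

/-- In each interval of `P`, moving the tag to the left endpoint costs `L ω ^ θ`, and refining the
resulting term costs `sewingConst θ` times as much by the sewing lemma. The costs add up by
`IsControl.sum_rpow_le`. -/
theorem HasSmallProducts.norm_youngSum_sub_left_le (h : HasSmallProducts f x ω s t θ δ L)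
    (hω : IsControl ω s t) (hθ : 1 < θ) (hL : 0 ≤ L) {P R : IntervalPartition s t} {φ : ℕ → ℕ}
    {τ : ℕ → ℝ} (hP : IsFineTagged δ P τ) (hφ : IntervalPartition.IsRefinement P R φ) :
    ‖youngSum f x (P, τ) - youngSum f x (R, R.pt)‖ ≤ (1 + sewingConst θ) * (L * ω s t ^ θ) := by
  set A : ℕ → ℕ → W := fun i j => f (R.pt i) (x (R.pt j) - x (R.pt i)) with hA
  have hR : youngSum f x (R, R.pt) =
      ∑ i ∈ Finset.range P.n, ∑ j ∈ Finset.Ico (φ i) (φ (i + 1)), A j (j + 1) := by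
    have key : ∀ m ≤ P.n, ∑ i ∈ Finset.range m, ∑ j ∈ Finset.Ico (φ i) (φ (i + 1)), A j (j + 1) =
        ∑ j ∈ Finset.range (φ m), A j (j + 1) := by
      intro m
      induction m with
      | zero => simp [hφ.zero]
      | succ m ih =>
        intro hm
        rw [Finset.sum_range_succ, ih (by omega),
          Finset.sum_range_add_sum_Ico _ (hφ.mono (Nat.le_succ m) hm)]
    rw [key _ le_rfl, hφ.last]
    rfl
  have hterm : ∀ i ∈ Finset.range P.n, ‖f (τ i) (x (P.pt (i + 1)) - x (P.pt i)) -
      ∑ j ∈ Finset.Ico (φ i) (φ (i + 1)), A j (j + 1)‖ ≤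
        (1 + sewingConst θ) * L * ω (P.pt i) (P.pt (i + 1)) ^ θ := by
    intro i hi
    have hi := Finset.mem_range.1 hi
    have hi' : i + 1 ≤ P.n := hi
    have h0 := P.pt_mem hi.le
    have h1 := P.pt_mem hi'
    have hlt := (P.pt_lt i hi).le
    have hmesh := hP.1 i hi
    have hφi : φ i ≤ φ (i + 1) := hφ.mono (Nat.le_succ i) hi'
    have hpt : ∀ j, j ≤ φ (i + 1) → R.pt j ≤ P.pt (i + 1) := fun j hj => by
      rw [← hφ.pt _ hi']
      exact R.pt_mono hj (hφ.le _ hi')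
    have hpt' : ∀ j, φ i ≤ j → j ≤ φ (i + 1) → P.pt i ≤ R.pt j := fun j hj hj' => by
      rw [← hφ.pt _ hi.le]
      exact R.pt_mono hj (hj'.trans (hφ.le _ hi'))
    have hsew := norm_sum_sub_le_of_almost_additive hθ hL (N := φ (i + 1) - φ i)
      (fun j k => A (φ i + j) (φ i + k)) (fun j k => ω (R.pt (φ i + j)) (R.pt (φ i + k)))
      (fun j => by simp [hA])
      (fun j k hjk hk => by
        have hk' : φ i + k ≤ φ (i + 1) := by omega
        exact hω.nonneg (h0.1.trans (hpt' _ (by omega) (by omega)))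
          (R.pt_mono (by omega) (hk'.trans (hφ.le _ hi'))) ((hpt _ hk').trans h1.2))
      (fun j k l hjk hkl hl => by
        have hl' : φ i + l ≤ φ (i + 1) := by omega
        have hlR := hl'.trans (hφ.le _ hi')
        exact hω.superadd (h0.1.trans (hpt' _ (by omega) (by omega)))
          (R.pt_mono (by omega) (by omega)) (R.pt_mono (by omega) hlR) ((hpt _ hl').trans h1.2))
      (fun j k l hjk hkl hl => by
        have hl' : φ i + l ≤ φ (i + 1) := by omega
        have hlR := hl'.trans (hφ.le _ hi')
        have hu := hpt' (φ i + j) (by omega) (by omega)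
        have hw := hpt _ hl'
        have hjk' : R.pt (φ i + j) ≤ R.pt (φ i + k) := R.pt_mono (by omega) (by omega)
        have hkl' : R.pt (φ i + k) ≤ R.pt (φ i + l) := R.pt_mono (by omega) hlR
        have := h (h0.1.trans hu) (hjk'.trans hkl') (hw.trans h1.2) (by linarith)
          (R.pt (φ i + j)) ⟨le_rfl, hjk'.trans hkl'⟩ (R.pt (φ i + k)) ⟨hjk', hkl'⟩
          (R.pt (φ i + l)) ⟨hjk'.trans hkl', le_rfl⟩ (R.pt (φ i + k)) ⟨hjk', hkl'⟩
        -- For `u ≤ v ≤ w` the defect `A u w - A u v - A v w` equals `(f u - f v) (x w - x v)`.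
        refine le_of_eq_of_le (congrArg norm ?_) this
        simp only [hA, LinearMap.sub_apply, map_sub]
        abel)
      0 (φ (i + 1) - φ i) (Nat.zero_le _) le_rfl
    have hsum : ∑ j ∈ Finset.Ico 0 (φ (i + 1) - φ i), A (φ i + j) (φ i + (j + 1)) =
        ∑ j ∈ Finset.Ico (φ i) (φ (i + 1)), A j (j + 1) := by
      rw [Finset.sum_Ico_eq_sum_range _ (φ i), ← Finset.range_eq_Ico]
      rfl
    simp only [Nat.add_sub_cancel' hφi, Nat.add_zero] at hsew
    rw [hsum, hφ.pt _ hi.le, hφ.pt _ hi'] at hsew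
    have htag := h h0.1 hlt h1.2 hmesh (τ i) (hP.2 i hi) (P.pt i) ⟨le_rfl, hlt⟩
      (P.pt (i + 1)) ⟨hlt, le_rfl⟩ (P.pt i) ⟨le_rfl, hlt⟩
    have hA' : A (φ i) (φ (i + 1)) = f (P.pt i) (x (P.pt (i + 1)) - x (P.pt i)) := by
      simp only [hA, hφ.pt _ hi.le, hφ.pt _ hi']
    rw [hA'] at hsew
    rw [LinearMap.sub_apply] at htag
    rw [norm_sub_rev] at hsew
    refine (norm_sub_le_norm_sub_add_norm_sub _
      (f (P.pt i) (x (P.pt (i + 1)) - x (P.pt i))) _).trans ?_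
    linarith
  rw [hR]
  simp only [youngSum]
  rw [← Finset.sum_sub_distrib]
  refine (norm_sum_le_of_le _ hterm).trans ?_
  rw [← Finset.mul_sum, ← mul_assoc]
  exact mul_le_mul_of_nonneg_left (hω.sum_rpow_le P hθ.le)
    (mul_nonneg (add_nonneg zero_le_one (sewingConst_nonneg hθ)) hL)

theorem HasSmallProducts.norm_youngSum_sub_le (h : HasSmallProducts f x ω s t θ δ L)
    (hω : IsControl ω s t) (hθ : 1 < θ) (hL : 0 ≤ L) {P Q : IntervalPartition s t}
    {τ σ : ℕ → ℝ} (hP : IsFineTagged δ P τ) (hQ : IsFineTagged δ Q σ) :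
    ‖youngSum f x (P, τ) - youngSum f x (Q, σ)‖ ≤
      2 * ((1 + sewingConst θ) * (L * ω s t ^ θ)) := by
  obtain ⟨R, φ, ψ, hφ, hψ⟩ := IntervalPartition.exists_common_refinement P Q
  have h1 := h.norm_youngSum_sub_left_le hω hθ hL hP hφ
  have h2 := h.norm_youngSum_sub_left_le hω hθ hL hQ hψ
  rw [norm_sub_rev] at h2
  refine (norm_sub_le_norm_sub_add_norm_sub _ (youngSum f x (R, R.pt)) _).trans ?_
  linarith

/-- Existence of the Young integral. -/
theorem exists_hasYoungIntegral [CompleteSpace W] (hst : s ≤ t) (hω : IsControl ω s t)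
    (hθ : 1 < θ) (h : ∀ ε > 0, ∃ δ > 0, HasSmallProducts f x ω s t θ δ ε) :
    ∃ I, HasYoungIntegral f x s t I := by
  have := youngFilter_neBot hst
  simp only [hasYoungIntegral_iff_tendsto]
  refine cauchy_map_iff_exists_tendsto.1 ?_
  rw [cauchy_map_iff, (((hasBasis_youngFilter s t).prod_self).tendsto_iff
    Metric.uniformity_basis_dist)]
  refine ⟨this, fun ε hε => ?_⟩
  -- The bound on the difference of two sums for `L = 1`. It may vanish, hence the division by `C +
  -- 1` below.
  set C := 2 * ((1 + sewingConst θ) * ω s t ^ θ) with hC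
  have hC0 : 0 ≤ C := mul_nonneg zero_le_two (mul_nonneg
    (add_nonneg zero_le_one (sewingConst_nonneg hθ))
    (Real.rpow_nonneg (hω.nonneg le_rfl hst le_rfl) _))
  obtain ⟨δ, hδ, hsmall⟩ := h (ε / (C + 1)) (by positivity)
  refine ⟨δ, hδ, fun R hR => ?_⟩
  have := hsmall.norm_youngSum_sub_le hω hθ (by positivity) hR.1 hR.2
  rw [Set.mem_ofPred_eq, dist_eq_norm]
  refine this.trans_lt ?_
  have : 2 * ((1 + sewingConst θ) * (ε / (C + 1) * ω s t ^ θ)) = ε * (C / (C + 1)) := by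
    rw [hC]
    ring
  rw [this]
  have : C / (C + 1) < 1 := (div_lt_one (by positivity)).2 (by linarith)
  nlinarith

/-- The Young–Loève estimate. -/
theorem HasYoungIntegral.norm_sub_le {I : W} (hI : HasYoungIntegral f x s t I) (hst : s ≤ t)
    (hω : IsControl ω s t) (hθ : 1 < θ) (hL : 0 ≤ L)
    (h : HasSmallProducts f x ω s t θ (t - s + 1) L) :
    ‖I - f s (x t - x s)‖ ≤ 2 * ((1 + sewingConst θ) * (L * ω s t ^ θ)) := by
  -- The estimate compares fine sums with the partition into one interval (none if `s = t`); its
  -- mesh is `t - s`, whence the threshold `t - s + 1`.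
  obtain ⟨Q, hQ, hQs⟩ : ∃ Q : IntervalPartition s t, IsFineTagged (t - s + 1) Q Q.pt ∧
      youngSum f x (Q, Q.pt) = f s (x t - x s) := by
    rcases hst.eq_or_lt with rfl | hlt
    · refine ⟨IntervalPartition.single s, isFineTagged_left ?_, ?_⟩
      · exact fun i hi => absurd hi (Nat.not_lt_zero i)
      · simp [youngSum, IntervalPartition.single]
    · refine ⟨IntervalPartition.uniform hlt 0, isFineTagged_left ?_, ?_⟩
      · intro i _
        simp only [IntervalPartition.uniform]
        push_cast
        linarith
      · simp [youngSum, IntervalPartition.uniform]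
  have := youngFilter_neBot hst
  rw [← hQs]
  refine le_of_tendsto ((hasYoungIntegral_iff_tendsto.1 hI).sub_const _).norm ?_
  filter_upwards [(hasBasis_youngFilter s t).mem_of_mem (show 0 < t - s + 1 by linarith)]
    with R hR
  exact h.norm_youngSum_sub_le hω hθ hL hR hQ

end Young

/-! ### Integrands and paths whose increments are bounded by powers of a control -/

section Controlled

variable {V W : Type*} [NormedAddCommGroup V] [NormedSpace ℝ V]
  [SeminormedAddCommGroup W] [NormedSpace ℝ W]

/-- The increments of `x` on `[a,b]` are at most `C ω ^ α`. -/
def IncrementsBoundedBy {E : Type*} [SeminormedAddCommGroup E] (x : ℝ → E) (ω : ℝ → ℝ → ℝ)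
    (a b α C : ℝ) : Prop :=
  ∀ ⦃s t⦄, a ≤ s → s ≤ t → t ≤ b → ‖x t - x s‖ ≤ C * ω s t ^ α

/-- The increments of the operator-valued function `f` on `[a,b]` are at most `C ω ^ α`. -/
def OperatorIncrementsBoundedBy (f : ℝ → V →ₗ[ℝ] W) (ω : ℝ → ℝ → ℝ) (a b α C : ℝ) : Prop :=
  ∀ ⦃s t⦄, a ≤ s → s ≤ t → t ≤ b → ∀ v, ‖(f t - f s) v‖ ≤ C * ω s t ^ α * ‖v‖

variable {f : ℝ → V →ₗ[ℝ] W} {x : ℝ → V} {ω : ℝ → ℝ → ℝ} {a b s t α C D : ℝ}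

theorem IncrementsBoundedBy.restrict {E : Type*} [SeminormedAddCommGroup E] {x : ℝ → E}
    (h : IncrementsBoundedBy x ω a b α C) (hs : a ≤ s) (ht : t ≤ b) :
    IncrementsBoundedBy x ω s t α C :=
  fun _ _ h1 h2 h3 => h (hs.trans h1) h2 (h3.trans ht)

theorem OperatorIncrementsBoundedBy.restrict
    (h : OperatorIncrementsBoundedBy f ω a b α C) (hs : a ≤ s) (ht : t ≤ b) :
    OperatorIncrementsBoundedBy f ω s t α C :=
  fun _ _ h1 h2 h3 => h (hs.trans h1) h2 (h3.trans ht)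

theorem IncrementsBoundedBy.norm_sub_le {E : Type*} [SeminormedAddCommGroup E] {x : ℝ → E}
    (h : IncrementsBoundedBy x ω a b α C) (hω : IsControl ω a b) (hα : 0 ≤ α) (hC : 0 ≤ C)
    {u w v v' : ℝ} (hu : a ≤ u) (hw : w ≤ b) (hv : v ∈ Set.Icc u w) (hv' : v' ∈ Set.Icc u w) :
    ‖x v - x v'‖ ≤ C * ω u w ^ α := by
  wlog hvv : v' ≤ v generalizing v v'
  · rw [norm_sub_rev]
    exact this hv' hv (le_of_not_ge hvv)
  refine (h (hu.trans hv'.1) hvv (hv.2.trans hw)).trans ?_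
  refine mul_le_mul_of_nonneg_left (Real.rpow_le_rpow ?_ ?_ hα) hC
  · exact hω.nonneg (hu.trans hv'.1) hvv (hv.2.trans hw)
  · exact hω.mono hu hv'.1 hvv hv.2 hw

theorem OperatorIncrementsBoundedBy.norm_sub_apply_le
    (h : OperatorIncrementsBoundedBy f ω a b α C) (hω : IsControl ω a b) (hα : 0 ≤ α) (hC : 0 ≤ C)
    {u w v v' : ℝ} (hu : a ≤ u) (hw : w ≤ b) (hv : v ∈ Set.Icc u w) (hv' : v' ∈ Set.Icc u w)
    (z : V) : ‖(f v - f v') z‖ ≤ C * ω u w ^ α * ‖z‖ := by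
  wlog hvv : v' ≤ v generalizing v v'
  · rw [← neg_sub, LinearMap.neg_apply, norm_neg]
    exact this hv' hv (le_of_not_ge hvv)
  refine (h (hu.trans hv'.1) hvv (hv.2.trans hw) z).trans ?_
  refine mul_le_mul_of_nonneg_right
    (mul_le_mul_of_nonneg_left (Real.rpow_le_rpow ?_ ?_ hα) hC) (norm_nonneg z)
  · exact hω.nonneg (hu.trans hv'.1) hvv (hv.2.trans hw)
  · exact hω.mono hu hv'.1 hvv hv.2 hw

theorem hasSmallProducts_of_controlled (hω : IsControl ω a b) (hα : 0 ≤ α) (hC : 0 ≤ C)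
    (hD : 0 ≤ D) (hf : OperatorIncrementsBoundedBy f ω a b α C)
    (hx : IncrementsBoundedBy x ω a b α D) (δ : ℝ) :
    HasSmallProducts f x ω a b (α + α) δ (C * D) := by
  intro u w hu huw hw _ v₁ h₁ v₂ h₂ v₃ h₃ v₄ h₄
  have hωu := hω.nonneg hu huw hw
  refine (hf.norm_sub_apply_le hω hα hC hu hw h₁ h₂ _).trans ?_
  refine (mul_le_mul_of_nonneg_left (hx.norm_sub_le hω hα hD hu hw h₃ h₄)
    (mul_nonneg hC (Real.rpow_nonneg hωu _))).trans (le_of_eq ?_)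
  rw [Real.rpow_add_of_nonneg hωu hα hα]
  ring

/-- By continuity of `x`, the constant can be made small at the expense of the exponent. -/
theorem exists_hasSmallProducts (hω : IsControl ω a b) (hα : 0 ≤ α) (hC : 0 ≤ C)
    (hD : 0 ≤ D) (hf : OperatorIncrementsBoundedBy f ω a b α C)
    (hx : IncrementsBoundedBy x ω a b α D) (hcont : ContinuousOn x (Set.Icc a b)) {r : ℝ}
    (hr0 : 0 ≤ r) (hr1 : r < 1) {ε : ℝ} (hε : 0 < ε) :
    ∃ δ > 0, HasSmallProducts f x ω a b (α + α * r) δ ε := by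
  have hr : 0 < 1 - r := sub_pos.2 hr1
  set B := C * D ^ r + 1 with hB
  have hDr := Real.rpow_nonneg hD r
  have hB0 : 0 < B := by positivity
  -- Chosen so that `C * D ^ r * η ^ (1 - r) ≤ ε`; the `+ 1` in `B` keeps the quotient meaningful
  -- when `C * D ^ r = 0`.
  set η := (ε / B) ^ (1 / (1 - r)) with hη
  have hη0 : 0 < η := Real.rpow_pos_of_pos (div_pos hε hB0) _
  have hηr : η ^ (1 - r) = ε / B := by
    rw [hη, ← Real.rpow_mul (div_pos hε hB0).le, one_div_mul_cancel hr.ne', Real.rpow_one]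
  obtain ⟨δ, hδ, hunif⟩ := Metric.uniformContinuousOn_iff.1
    (isCompact_Icc.uniformContinuousOn_of_continuous hcont) η hη0
  refine ⟨δ, hδ, ?_⟩
  intro u w hu huw hw hδw v₁ h₁ v₂ h₂ v₃ h₃ v₄ h₄
  have hωu := hω.nonneg hu huw hw
  have hωα := Real.rpow_nonneg hωu α
  have hx1 := hx.norm_sub_le hω hα hD hu hw h₃ h₄
  have hx2 : ‖x v₃ - x v₄‖ ≤ η := by
    rw [← dist_eq_norm]
    refine (hunif v₃ ⟨hu.trans h₃.1, h₃.2.trans hw⟩ v₄ ⟨hu.trans h₄.1, h₄.2.trans hw⟩ ?_).le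
    rw [Real.dist_eq, abs_lt]
    constructor <;> linarith [h₃.1, h₃.2, h₄.1, h₄.2]
  -- Interpolation: the power `r` of the increment is bounded by the control, the power `1 - r` by
  -- uniform continuity.
  have hsplit : ‖x v₃ - x v₄‖ ≤ (D * ω u w ^ α) ^ r * η ^ (1 - r) := by
    calc ‖x v₃ - x v₄‖ = ‖x v₃ - x v₄‖ ^ r * ‖x v₃ - x v₄‖ ^ (1 - r) := by
          rw [← Real.rpow_add_of_nonneg (norm_nonneg _) hr0 hr.le, add_sub_cancel, Real.rpow_one]
      _ ≤ _ := by gcongr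
  refine (hf.norm_sub_apply_le hω hα hC hu hw h₁ h₂ _).trans ?_
  calc C * ω u w ^ α * ‖x v₃ - x v₄‖
      ≤ C * ω u w ^ α * ((D * ω u w ^ α) ^ r * η ^ (1 - r)) := by gcongr
    _ = (C * D ^ r) * (ε / B) * ω u w ^ (α + α * r) := by
        rw [Real.mul_rpow hD hωα, ← Real.rpow_mul hωu,
          Real.rpow_add_of_nonneg hωu hα (mul_nonneg hα hr0), hηr]
        ring
    _ ≤ B * (ε / B) * ω u w ^ (α + α * r) := by
        gcongr
        linarith
    _ = ε * ω u w ^ (α + α * r) := by rw [mul_div_cancel₀ _ hB0.ne']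

/-- Young's theorem: existence of the integral of controlled functions. -/
theorem exists_hasYoungIntegral_of_controlled [CompleteSpace W] (hab : a ≤ b)
    (hω : IsControl ω a b) (hα : 1 / 2 < α) (hC : 0 ≤ C) (hD : 0 ≤ D)
    (hf : OperatorIncrementsBoundedBy f ω a b α C)
    (hx : IncrementsBoundedBy x ω a b α D) (hcont : ContinuousOn x (Set.Icc a b)) :
    ∃ I, HasYoungIntegral f x a b I := by
  have hα0 : 0 < α := by linarith
  -- `r > 1 / α - 1` means `α * (1 + r) > 1`; this is compatible with `r < 1` because `α > 1 / 2`.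
  obtain ⟨r, hr1, hr2⟩ : ∃ r, max 0 (1 / α - 1) < r ∧ r < 1 := by
    refine exists_between (max_lt one_pos ?_)
    have : 1 / α < 2 := by
      rw [div_lt_iff₀ hα0]
      linarith
    linarith
  obtain ⟨hr0, hr3⟩ := max_lt_iff.1 hr1
  have hθ : 1 < α + α * r := by
    have : 1 / α < 1 + r := by linarith
    rw [div_lt_iff₀ hα0] at this
    linarith
  exact exists_hasYoungIntegral hab hω hθ fun ε hε =>
    exists_hasSmallProducts hω hα0.le hC hD hf hx hcont hr0.le hr2 hε

/-- The indefinite Young integral of a controlled function is controlled. -/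
theorem exists_incrementsBoundedBy_youngIntegral [CompleteSpace W] [T2Space W] (hab : a ≤ b)
    (hω : IsControl ω a b) (hα : 1 / 2 < α) (hC : 0 ≤ C) (hD : 0 ≤ D)
    (hf : OperatorIncrementsBoundedBy f ω a b α C)
    (hx : IncrementsBoundedBy x ω a b α D) (hcont : ContinuousOn x (Set.Icc a b))
    {M : ℝ} (hM0 : 0 ≤ M) (hM : ∀ v, ‖f a v‖ ≤ M * ‖v‖) :
    ∃ K, 0 ≤ K ∧ IncrementsBoundedBy (fun t => youngIntegral f x a t) ω a b α K := by
  have hα0 : 0 < α := by linarith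
  have hθ : 1 < α + α := by linarith
  have hωab := Real.rpow_nonneg (hω.nonneg le_rfl hab le_rfl) α
  have hS := sewingConst_nonneg hθ
  -- The first term bounds `f s (x t - x s)`, with `C * ω a b ^ α + M` a uniform bound for `f`. The
  -- second is the Young–Loève error, where one of the two factors `ω s t ^ α` is replaced by `ω a b
  -- ^ α`.
  refine ⟨(C * ω a b ^ α + M) * D + 2 * ((1 + sewingConst (α + α)) * (C * D * ω a b ^ α)),
    by positivity, ?_⟩
  intro s t hs hst ht
  have hint : ∀ u v, a ≤ u → u ≤ v → v ≤ b → ∃ I, HasYoungIntegral f x u v I :=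
    fun u v hu huv hv => exists_hasYoungIntegral_of_controlled huv (hω.restrict hu hv) hα hC hD
      (hf.restrict hu hv) (hx.restrict hu hv) (hcont.mono (Set.Icc_subset_Icc hu hv))
  obtain ⟨I, hI⟩ := hint s t hs hst ht
  have hadj : youngIntegral f x a t - youngIntegral f x a s = I := by
    rw [(hasYoungIntegral_youngIntegral (hint a s le_rfl hs (hst.trans ht))).adjacent hs hst hI
      (hasYoungIntegral_youngIntegral (hint a t le_rfl (hs.trans hst) ht)), add_sub_cancel_left]
  have hωst := hω.nonneg hs hst ht
  have hωα := Real.rpow_nonneg hωst α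
  have hωle : ω s t ^ α ≤ ω a b ^ α :=
    Real.rpow_le_rpow hωst (hω.mono le_rfl hs hst ht le_rfl) hα0.le
  have hloeve := hI.norm_sub_le hst (hω.restrict hs ht) hθ (mul_nonneg hC hD)
    (hasSmallProducts_of_controlled (hω.restrict hs ht) hα0.le hC hD (hf.restrict hs ht)
      (hx.restrict hs ht) _)
  have hfs : ∀ v, ‖f s v‖ ≤ (C * ω a b ^ α + M) * ‖v‖ := fun v => by
    have h1 := hf.norm_sub_apply_le hω hα0.le hC le_rfl le_rfl (v := s) (v' := a)
      ⟨hs, hst.trans ht⟩ ⟨le_rfl, hab⟩ v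
    rw [LinearMap.sub_apply] at h1
    have h2 := norm_le_norm_sub_add (f s v) (f a v)
    linarith [hM v]
  have hmain : ‖f s (x t - x s)‖ ≤ (C * ω a b ^ α + M) * (D * ω s t ^ α) :=
    (hfs _).trans (mul_le_mul_of_nonneg_left (hx hs hst ht) (by positivity))
  have htri := norm_le_norm_sub_add I (f s (x t - x s))
  rw [Real.rpow_add_of_nonneg hωst hα0.le hα0.le] at hloeve
  have hquad : C * D * (ω s t ^ α * ω s t ^ α) ≤ C * D * (ω a b ^ α * ω s t ^ α) := by gcongr
  have hquad' := mul_le_mul_of_nonneg_left hquad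
    (show 0 ≤ 2 * (1 + sewingConst (α + α)) by positivity)
  simp only [hadj]
  nlinarith

end Controlled

/-! ### The control given by the `p`-variation -/

section Variation

variable {V : Type*} [NormedAddCommGroup V] {p a b c s t u : ℝ} {x : ℝ → V}

/-- The `p`-th power of the `p`-variation. -/
def variationPow (p : ℝ) (x : ℝ → V) (s t : ℝ) : ℝ≥0∞ :=
  ⨆ P : IntervalPartition s t, ∑ i ∈ Finset.range P.n, ‖x (P.pt (i + 1)) - x (P.pt i)‖ₑ ^ p

theorem pVariation_lt_top_iff (hp : 0 < p) : pVariation p x s t < ∞ ↔ variationPow p x s t < ∞ :=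
  ENNReal.rpow_lt_top_iff_of_pos (one_div_pos.2 hp)

theorem variationPow_superadd (hsu : s ≤ u) (hut : u ≤ t) :
    variationPow p x s u + variationPow p x u t ≤ variationPow p x s t := by
  have := IntervalPartition.nonempty hsu
  have := IntervalPartition.nonempty hut
  refine ENNReal.iSup_add_iSup_le fun P Q => ?_
  rw [← P.sum_concat Q fun y z => ‖x z - x y‖ₑ ^ p]
  exact le_iSup (fun R : IntervalPartition s t =>
    ∑ i ∈ Finset.range R.n, ‖x (R.pt (i + 1)) - x (R.pt i)‖ₑ ^ p) (P.concat Q)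

theorem variationPow_mono (hsu : s ≤ u) (hut : u ≤ t) (htc : t ≤ c) :
    variationPow p x u t ≤ variationPow p x s c :=
  (le_add_self.trans (variationPow_superadd hsu hut)).trans
    (le_self_add.trans (variationPow_superadd (hsu.trans hut) htc))

theorem enorm_sub_rpow_le_variationPow (hp : 0 < p) (hst : s ≤ t) :
    ‖x t - x s‖ₑ ^ p ≤ variationPow p x s t := by
  rcases hst.eq_or_lt with rfl | hlt
  · simp [hp]
  · refine le_iSup_of_le (IntervalPartition.uniform hlt 0) ?_
    simp [IntervalPartition.uniform]

theorem variationPow_congr {y : ℝ → V}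
    (h : ∀ u ∈ Set.Icc s t, ∀ v ∈ Set.Icc s t, x v - x u = y v - y u) :
    variationPow p x s t = variationPow p y s t := by
  refine iSup_congr fun P => Finset.sum_congr rfl fun i hi => ?_
  have hi := Finset.mem_range.1 hi
  rw [h _ (P.pt_mem hi.le) _ (P.pt_mem (show i + 1 ≤ P.n from hi))]

/-- Finiteness matters: `toReal` sends `∞` to `0`, which could break superadditivity. -/
theorem isControl_variationPow (h : variationPow p x a b < ∞) :
    IsControl (fun s t => (variationPow p x s t).toReal) a b where
  nonneg _ _ _ _ _ := ENNReal.toReal_nonneg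
  superadd s u t h1 h2 h3 h4 := by
    have hlt := ((variationPow_mono h1 (h2.trans h3) h4).trans_lt h)
    have hle := variationPow_superadd (p := p) (x := x) h2 h3
    have hadd := hle.trans_lt hlt
    rw [← ENNReal.toReal_add (ENNReal.add_lt_top.1 hadd).1.ne (ENNReal.add_lt_top.1 hadd).2.ne]
    exact ENNReal.toReal_mono hlt.ne hle

theorem incrementsBoundedBy_variationPow (hp : 0 < p) (h : variationPow p x a b < ∞) :
    IncrementsBoundedBy x (fun s t => (variationPow p x s t).toReal) a b (1 / p) 1 := by
  intro s t hs hst ht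
  have hlt := ((variationPow_mono hs hst ht).trans_lt h)
  have hle := ENNReal.toReal_mono hlt.ne (enorm_sub_rpow_le_variationPow (x := x) hp hst)
  rw [← ENNReal.toReal_rpow, toReal_enorm] at hle
  have := Real.rpow_le_rpow (Real.rpow_nonneg (norm_nonneg _) _) hle (one_div_pos.2 hp).le
  rwa [← Real.rpow_mul (norm_nonneg _), mul_one_div_cancel hp.ne', Real.rpow_one, ← one_mul
    ((variationPow p x s t).toReal ^ _)] at this

/-- The sum of the `p`-th powers of the increments along a monotone sequence is at most the
`p`-th power of the `p`-variation. -/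
theorem sum_enorm_rpow_le_variationPow (hp : 0 < p) {q : ℕ → ℝ} {n : ℕ}
    (hq : MonotoneOn q (Set.Iic n)) :
    ∑ i ∈ Finset.range n, ‖x (q (i + 1)) - x (q i)‖ₑ ^ p ≤ variationPow p x (q 0) (q n) := by
  induction n with
  | zero => simp
  | succ n ih =>
    rw [Finset.sum_range_succ]
    have hqn : q n ≤ q (n + 1) :=
      hq (Set.mem_Iic.2 n.le_succ) (Set.mem_Iic.2 le_rfl) n.le_succ
    have hq0 : q 0 ≤ q n := hq (Set.mem_Iic.2 (Nat.zero_le _)) (Set.mem_Iic.2 n.le_succ) n.zero_le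
    refine (add_le_add (ih (hq.mono (Set.Iic_subset_Iic.2 n.le_succ)))
      (enorm_sub_rpow_le_variationPow hp hqn)).trans (variationPow_superadd hq0 hqn)

/-- Additivity of the finiteness of the `p`-variation. -/
theorem variationPow_lt_top_of_adjacent (hp : 1 ≤ p) (hab : a ≤ b) (hbc : b ≤ c)
    (h1 : variationPow p x a b < ∞) (h2 : variationPow p x b c < ∞) :
    variationPow p x a c < ∞ := by
  have hp0 : 0 < p := by linarith
  refine lt_of_le_of_lt (b := 2 ^ (p - 1) * (variationPow p x a b + variationPow p x b c)) ?_
    (ENNReal.mul_lt_top (ENNReal.rpow_lt_top_of_nonneg (by linarith) (by simp))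
      (ENNReal.add_lt_top.2 ⟨h1, h2⟩))
  refine iSup_le fun P => ?_
  -- Truncating at `b` sends the points of `P` into `[a,b]` and `[b,c]`. The truncated sequences may
  -- repeat points, so they are only monotone.
  have hmin : MonotoneOn (fun i => min (P.pt i) b) (Set.Iic P.n) :=
    fun i hi j hj hij => min_le_min_right b (P.monotoneOn hi hj hij)
  have hmax : MonotoneOn (fun i => max (P.pt i) b) (Set.Iic P.n) :=
    fun i hi j hj hij => max_le_max_right b (P.monotoneOn hi hj hij)
  have e1 := sum_enorm_rpow_le_variationPow (x := x) hp0 hmin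
  have e2 := sum_enorm_rpow_le_variationPow (x := x) hp0 hmax
  simp only [P.pt_zero, P.pt_last, min_eq_left hab, min_eq_right hbc, max_eq_right hab,
    max_eq_left hbc] at e1 e2
  refine le_trans ?_ (mul_le_mul_right (add_le_add e1 e2) _)
  rw [← Finset.sum_add_distrib, Finset.mul_sum]
  refine Finset.sum_le_sum fun i hi => ?_
  refine le_trans ?_ (ENNReal.rpow_add_le_mul_rpow_add_rpow _ _ hp)
  refine ENNReal.rpow_le_rpow ?_ hp0.le
  -- Hence every increment, even one straddling `b`, is the sum of its two truncated increments;
  -- convexity of the `p`-th power yields the factor `2 ^ (p - 1)`.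
  have hdecomp : ∀ r, x r = x (min r b) + x (max r b) - x b := fun r => by
    rcases le_total r b with h | h <;> simp [h]
  refine le_of_eq_of_le (congrArg enorm ?_) (enorm_add_le _ _)
  rw [hdecomp (P.pt (i + 1)), hdecomp (P.pt i)]
  abel

end Variation

/-! ### Concatenation of paths -/

section Concat

variable {V : Type*} [NormedAddCommGroup V] {p a b c : ℝ} {x y : ℝ → V}

theorem concatPath_of_le {t : ℝ} (h : t ≤ b) : concatPath b x y t = x t := if_pos h

theorem concatPath_of_ge {t : ℝ} (h : b ≤ t) : concatPath b x y t = y t - y b + x b := by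
  rcases h.eq_or_lt with rfl | h
  · simp [concatPath]
  · exact if_neg (not_le.2 h)

theorem concatPath_sub_left {s t : ℝ} (hs : s ≤ b) (ht : t ≤ b) :
    concatPath b x y t - concatPath b x y s = x t - x s := by
  rw [concatPath_of_le hs, concatPath_of_le ht]

theorem concatPath_sub_right {s t : ℝ} (hs : b ≤ s) (ht : b ≤ t) :
    concatPath b x y t - concatPath b x y s = y t - y s := by
  rw [concatPath_of_ge hs, concatPath_of_ge ht]
  abel

theorem concatPath_mem_pVarPaths (hp : 1 ≤ p) (hab : a ≤ b) (hbc : b ≤ c)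
    (hx : x ∈ pVarPaths V p a b) (hy : y ∈ pVarPaths V p b c) :
    concatPath b x y ∈ pVarPaths V p a c := by
  have hp0 : 0 < p := by linarith
  refine ⟨?_, ?_⟩
  · rw [← Set.Icc_union_Icc_eq_Icc hab hbc]
    refine ContinuousOn.union_of_isClosed ?_ ?_ isClosed_Icc isClosed_Icc
    · exact hx.1.congr fun t ht => concatPath_of_le ht.2
    · exact ((hy.1.sub continuousOn_const).add continuousOn_const).congr
        fun t ht => concatPath_of_ge ht.1
  · rw [pVariation_lt_top_iff hp0]
    refine variationPow_lt_top_of_adjacent hp hab hbc ?_ ?_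
    · rw [variationPow_congr fun u hu v hv => concatPath_sub_left hu.2 hv.2]
      exact (pVariation_lt_top_iff hp0).1 hx.2
    · rw [variationPow_congr fun u hu v hv => concatPath_sub_right hu.1 hv.1]
      exact (pVariation_lt_top_iff hp0).1 hy.2

end Concat

/-! ### Tensor powers of a finite-dimensional normed space -/

section TensorPower

variable {V : Type*}

/-- In finite dimension, the projective seminorm is a norm. -/
theorem TensorPower.eq_zero_of_norm_eq_zero [NormedAddCommGroup V] [NormedSpace ℝ V]
    [FiniteDimensional ℝ V] {k : ℕ} {z : ⨂[ℝ]^k V} (hz : ‖z‖ = 0) : z = 0 := by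
  classical
  set b := Module.finBasis ℝ V
  set B := Basis.piTensorProduct (R := ℝ) (ι := Fin k) fun _ => b
  refine B.ext_elem fun q => ?_
  -- The product of coordinate functionals lifts to the coordinate `q` of the tensor basis, so each
  -- coordinate is dominated by the projective seminorm.
  set g : ContinuousMultilinearMap ℝ (fun _ : Fin k => V) ℝ :=
    (ContinuousMultilinearMap.mkPiAlgebra ℝ (Fin k) ℝ).compContinuousLinearMap
      fun i => LinearMap.toContinuousLinearMap (b.coord (q i)) with hg
  have hlift : PiTensorProduct.lift g.toMultilinearMap = B.coord q := by
    refine PiTensorProduct.ext ?_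
    ext m
    simp [hg, B]
  have := PiTensorProduct.norm_eval_le_projectiveSeminorm g z
  rw [hz, mul_zero, hlift] at this
  simpa using this

instance TensorPower.instT2Space [NormedAddCommGroup V] [NormedSpace ℝ V]
    [FiniteDimensional ℝ V] (k : ℕ) : T2Space (⨂[ℝ]^k V) := by
  have : T0Space (⨂[ℝ]^k V) := ⟨fun y z h => by
    rw [Metric.inseparable_iff, dist_eq_norm] at h
    exact sub_eq_zero.1 (TensorPower.eq_zero_of_norm_eq_zero h)⟩
  infer_instance

instance TensorPower.instCompleteSpace [NormedAddCommGroup V] [NormedSpace ℝ V]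
    [FiniteDimensional ℝ V] (k : ℕ) : CompleteSpace (⨂[ℝ]^k V) :=
  FiniteDimensional.complete ℝ _

variable [AddCommGroup V] [Module ℝ V]

/-- The product of tensor powers as a bilinear map. -/
def TensorPower.mulBilin (V : Type*) [AddCommGroup V] [Module ℝ V] (i j : ℕ) :
    ⨂[ℝ]^i V →ₗ[ℝ] ⨂[ℝ]^j V →ₗ[ℝ] ⨂[ℝ]^(i + j) V :=
  (TensorProduct.mk ℝ _ _).compr₂ ↑(TensorPower.mulEquiv : _ ≃ₗ[ℝ] ⨂[ℝ]^(i + j) V)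

/-- `tensorRight` as a bilinear map. -/
def tensorRightBilin (V : Type*) [AddCommGroup V] [Module ℝ V] (k : ℕ) :
    ⨂[ℝ]^k V →ₗ[ℝ] V →ₗ[ℝ] ⨂[ℝ]^(k + 1) V :=
  LinearMap.mk₂ ℝ (fun s v => tensorRight s v)
    (fun s s' v => by
      change TensorPower.mulBilin V k 1 (s + s') _ = _
      rw [map_add]
      rfl)
    (fun r s v => by
      change TensorPower.mulBilin V k 1 (r • s) _ = _
      rw [map_smul]
      rfl)
    (fun s v v' => map_add _ _ _) (fun r s v => map_smul _ _ _)

theorem tensorRightBilin_apply {k : ℕ} (s : ⨂[ℝ]^k V) : tensorRightBilin V k s = tensorRight s :=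
  rfl

theorem tensorRight_cast {k l : ℕ} (h : k = l) (s : ⨂[ℝ]^k V) (v : V) :
    tensorRight (TensorPower.cast ℝ V h s) v =
      TensorPower.cast ℝ V (congrArg (· + 1) h) (tensorRight s v) := by
  subst h
  simp

theorem cast_tensorRight_mul {k l : ℕ} (s : ⨂[ℝ]^k V) (w : ⨂[ℝ]^l V) (v : V) :
    TensorPower.cast ℝ V (add_assoc k l 1) (tensorRight (TensorPower.mulBilin V k l s w) v) =
      TensorPower.mulBilin V k (l + 1) s (tensorRight w v) :=
  TensorPower.mul_assoc s w _

/-- The product `s ⊗ w` as an element of the tensor power of degree `n = k + l`. -/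
def tensorMulCast (V : Type*) [AddCommGroup V] [Module ℝ V] {k l n : ℕ} (h : k + l = n) :
    ⨂[ℝ]^k V →ₗ[ℝ] ⨂[ℝ]^l V →ₗ[ℝ] ⨂[ℝ]^n V :=
  (TensorPower.mulBilin V k l).compr₂ (TensorPower.cast ℝ V h).toLinearMap

/-- Associativity, in the form that takes the constant left factor `s` out of an integral against
`dy`. -/
theorem tensorRight_tensorMulCast {k l n : ℕ} (h : k + l = n) (s : ⨂[ℝ]^k V) (w : ⨂[ℝ]^l V) :
    tensorRight (tensorMulCast V h s w) =
      tensorMulCast V (show k + (l + 1) = n + 1 by omega) s ∘ₗ tensorRight w := by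
  ext v
  subst h
  change tensorRight (TensorPower.cast ℝ V rfl _) v =
    TensorPower.cast ℝ V _ (TensorPower.mulBilin V k (l + 1) s (tensorRight w v))
  rw [tensorRight_cast, ← cast_tensorRight_mul, TensorPower.cast_cast]

theorem tensorMulCast_one {k : ℕ} (s : ⨂[ℝ]^k V) (h : k + 0 = k) :
    tensorMulCast V h s (GradedMonoid.GOne.one (A := fun k : ℕ => ⨂[ℝ]^k V)) = s :=
  TensorPower.mul_one s

/-- Degrees such as `k + 1 - l` and `k - l + 1` agree as numbers but give different types; this
passes between them. -/
theorem tensorMulCast_congr (v w : TensorSeries V) {k l l' n : ℕ} (h : k + l = n)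
    (h' : k + l' = n) : tensorMulCast V h (v k) (w l) = tensorMulCast V h' (v k) (w l') := by
  obtain rfl : l = l' := by omega
  rfl

theorem TensorSeries.mul_apply (v w : TensorSeries V) (n : ℕ) :
    (v * w) n = ∑ l : Fin (n + 1),
      tensorMulCast V (Nat.add_sub_of_le (Nat.le_of_lt_succ l.isLt)) (v l) (w (n - l)) :=
  rfl

theorem LinearMap.exists_bilinear_bound {E F G : Type*} [SeminormedAddCommGroup E]
    [NormedSpace ℝ E] [SeminormedAddCommGroup F] [NormedSpace ℝ F] [SeminormedAddCommGroup G]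
    [NormedSpace ℝ G] [FiniteDimensional ℝ E] [T2Space E] [FiniteDimensional ℝ F] [T2Space F]
    (B : E →ₗ[ℝ] F →ₗ[ℝ] G) : ∃ C, 0 ≤ C ∧ ∀ u v, ‖B u v‖ ≤ C * ‖u‖ * ‖v‖ :=
  ⟨‖B.toContinuousBilinearMap‖, ContinuousLinearMap.opNorm_nonneg _, fun u v => B.toContinuousBilinearMap.le_opNorm₂ u v⟩

theorem exists_norm_tensorRight_le (V : Type*) [NormedAddCommGroup V] [NormedSpace ℝ V]
    [FiniteDimensional ℝ V] (k : ℕ) :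
    ∃ C, 0 ≤ C ∧ ∀ (s : ⨂[ℝ]^k V) (v : V), ‖tensorRight s v‖ ≤ C * ‖s‖ * ‖v‖ :=
  LinearMap.exists_bilinear_bound (tensorRightBilin V k)

end TensorPower

/-! ### Iterated integrals -/

section Signature

variable {V : Type*} [NormedAddCommGroup V] [NormedSpace ℝ V] {p a b c : ℝ} {x y : ℝ → V}

theorem iteratedIntegral_congr (hxy : ∀ u ∈ Set.Icc a b, ∀ v ∈ Set.Icc a b,
    x v - x u = y v - y u) (k : ℕ) {t : ℝ} (ht : t ∈ Set.Icc a b) :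
    iteratedIntegral x a k t = iteratedIntegral y a k t := by
  induction k generalizing t with
  | zero => rfl
  | succ k ih =>
    have hsub : Set.Icc a t ⊆ Set.Icc a b := Set.Icc_subset_Icc_right ht.2
    exact youngIntegral_congr (fun u hu => by rw [ih (hsub hu)])
      fun u hu v hv => hxy u (hsub hu) v (hsub hv)

variable [FiniteDimensional ℝ V]

theorem exists_operatorIncrementsBoundedBy_tensorRight {k : ℕ} {z : ℝ → ⨂[ℝ]^k V}
    {ω : ℝ → ℝ → ℝ} {α C : ℝ} (hC : 0 ≤ C) (hz : IncrementsBoundedBy z ω a b α C) :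
    ∃ D, 0 ≤ D ∧ OperatorIncrementsBoundedBy (fun u => tensorRight (z u)) ω a b α D := by
  obtain ⟨K, hK, hbound⟩ := exists_norm_tensorRight_le V k
  refine ⟨K * C, mul_nonneg hK hC, fun s t hs hst ht v => ?_⟩
  simp only [← tensorRightBilin_apply, ← map_sub]
  simp only [tensorRightBilin_apply]
  refine (hbound _ v).trans ?_
  rw [mul_assoc K C]
  exact mul_le_mul_of_nonneg_right (mul_le_mul_of_nonneg_left (hz hs hst ht) hK) (norm_nonneg v)

/-- Regularity propagates through the degrees: tensoring preserves the exponent `1 / p`, and so does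
integration because `1 / p > 1 / 2`. -/
theorem exists_incrementsBoundedBy_iteratedIntegral (hp1 : 1 ≤ p) (hp2 : p < 2) (hab : a ≤ b)
    (hx : x ∈ pVarPaths V p a b) (k : ℕ) :
    ∃ C, 0 ≤ C ∧ IncrementsBoundedBy (iteratedIntegral x a k)
      (fun s t => (variationPow p x s t).toReal) a b (1 / p) C := by
  have hp0 : 0 < p := by linarith
  have hvar := (pVariation_lt_top_iff hp0).1 hx.2
  induction k with
  | zero =>
    refine ⟨0, le_rfl, fun s t _ _ _ => ?_⟩
    simp [iteratedIntegral]
  | succ k ih =>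
    obtain ⟨C, hC, hbound⟩ := ih
    obtain ⟨D, hD, hop⟩ := exists_operatorIncrementsBoundedBy_tensorRight hC hbound
    obtain ⟨K, hK, htr⟩ := exists_norm_tensorRight_le V k
    exact exists_incrementsBoundedBy_youngIntegral hab (isControl_variationPow hvar)
      (one_div_lt_one_div_of_lt hp0 hp2) hD zero_le_one hop
      (incrementsBoundedBy_variationPow hp0 hvar) hx.1
      (mul_nonneg hK (norm_nonneg _)) (htr (iteratedIntegral x a k a))

/-- The integrals that define the signature exist on all subintervals. -/
theorem exists_hasYoungIntegral_iteratedIntegral (hp1 : 1 ≤ p) (hp2 : p < 2)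
    (hx : x ∈ pVarPaths V p a b) (k : ℕ) {s t : ℝ} (hs : a ≤ s) (hst : s ≤ t) (ht : t ≤ b) :
    ∃ I, HasYoungIntegral (fun u => tensorRight (iteratedIntegral x a k u)) x s t I := by
  have hp0 : 0 < p := by linarith
  have hvar := (pVariation_lt_top_iff hp0).1 hx.2
  obtain ⟨C, hC, hbound⟩ := exists_incrementsBoundedBy_iteratedIntegral hp1 hp2
    (hs.trans (hst.trans ht)) hx k
  obtain ⟨D, hD, hop⟩ := exists_operatorIncrementsBoundedBy_tensorRight hC hbound
  exact exists_hasYoungIntegral_of_controlled hst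
    ((isControl_variationPow hvar).restrict hs ht) (one_div_lt_one_div_of_lt hp0 hp2) hD
    zero_le_one (hop.restrict hs ht) ((incrementsBoundedBy_variationPow hp0 hvar).restrict hs ht)
    (hx.1.mono (Set.Icc_subset_Icc hs ht))

theorem signatureWellDefined_of_mem_pVarPaths (hp1 : 1 ≤ p) (hp2 : p < 2)
    (hx : x ∈ pVarPaths V p a b) : SignatureWellDefined x a b := fun k t ht => by
  obtain ⟨I, hI⟩ := exists_hasYoungIntegral_iteratedIntegral hp1 hp2 hx k le_rfl ht.1 ht.2
  exact ⟨I, hI, fun J hJ => HasYoungIntegral.unique ht.1 hJ hI⟩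

theorem iteratedIntegral_succ_self (hp1 : 1 ≤ p) (hp2 : p < 2)
    (hx : x ∈ pVarPaths V p a b) {k : ℕ} {t : ℝ} (ht : t ∈ Set.Icc a b) :
    HasYoungIntegral (fun u => tensorRight (iteratedIntegral x a k u)) x a t
      (iteratedIntegral x a (k + 1) t) :=
  hasYoungIntegral_youngIntegral
    (exists_hasYoungIntegral_iteratedIntegral hp1 hp2 hx k le_rfl ht.1 ht.2)

/-- Chen's relation, with a variable upper endpoint. -/
theorem signature_concatPath (hp1 : 1 ≤ p) (hp2 : p < 2) (hab : a ≤ b)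
    (hx : x ∈ pVarPaths V p a b) (hy : y ∈ pVarPaths V p b c) (k : ℕ) {t : ℝ}
    (ht : t ∈ Set.Icc b c) :
    signature (concatPath b x y) a t k = (signature x a b * signature y b t) k := by
  have hbc := ht.1.trans ht.2
  have hz := concatPath_mem_pVarPaths hp1 hab hbc hx hy
  induction k generalizing t with
  | zero =>
    rw [TensorSeries.mul_apply, Fin.sum_univ_one]
    exact (tensorMulCast_one (signature x a b 0) rfl).symm
  | succ k ih =>
    obtain ⟨J, hJ⟩ :=
      exists_hasYoungIntegral_iteratedIntegral hp1 hp2 hz k hab ht.1 ht.2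
    have hleft := iteratedIntegral_succ_self hp1 hp2 hz (k := k)
      (t := b) ⟨hab, hbc⟩
    have hsplit := hleft.adjacent hab ht.1 hJ (iteratedIntegral_succ_self hp1 hp2
      hz (k := k) ⟨hab.trans ht.1, ht.2⟩)
    rw [iteratedIntegral_congr (y := x) (fun u hu v hv => concatPath_sub_left hu.2 hv.2) (k + 1)
      ⟨hab, le_rfl⟩] at hsplit
    -- Left multiplication by the constant `S(x)^(l)` is a continuous linear map, so it commutes
    -- with the integral that raises the degree of `S(y)`.
    have hterm : ∀ l : Fin (k + 1), HasYoungIntegral (fun u => tensorRight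
        (tensorMulCast V (Nat.add_sub_of_le (Nat.le_of_lt_succ l.isLt))
          (signature x a b l) (signature y b u (k - l)))) y b t
        (tensorMulCast V (show (l : ℕ) + (k - l + 1) = k + 1 by omega) (signature x a b l)
          (signature y b t (k - l + 1))) := fun l => by
      simp only [tensorRight_tensorMulCast]
      exact (iteratedIntegral_succ_self hp1 hp2 hy ht).map _
        (LinearMap.continuous_of_finiteDimensional _)
    have hright := HasYoungIntegral.sum Finset.univ fun l _ => hterm l
    have hJ' : J = ∑ l : Fin (k + 1),
        tensorMulCast V (show (l : ℕ) + (k - l + 1) = k + 1 by omega) (signature x a b l)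
          (signature y b t (k - l + 1)) := by
      refine HasYoungIntegral.unique ht.1 hJ ((hasYoungIntegral_congr (fun u hu => ?_)
        fun u hu v hv => concatPath_sub_right hu.1 hv.1).2 hright)
      -- The integrand is needed at every `u` in `[b,t]`, which is why the induction keeps the
      -- endpoint free.
      have := ih (t := u) ⟨hu.1, hu.2.trans ht.2⟩
      rw [TensorSeries.mul_apply] at this
      change tensorRight (signature (concatPath b x y) a u k) = _
      rw [this]
      simp only [← tensorRightBilin_apply, map_sum]
    -- The last summand, `l = k + 1`, is the integral over `[a,b]` tensored with `1`; the others
    -- form `J`.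
    rw [TensorSeries.mul_apply, Fin.sum_univ_castSucc]
    change iteratedIntegral (concatPath b x y) a (k + 1) t = _
    rw [hsplit, hJ']
    refine (add_comm _ _).trans (congrArg₂ (· + ·) ?_ ?_)
    · exact Finset.sum_congr rfl fun l _ => tensorMulCast_congr _ _ _ _
    · exact ((tensorMulCast_congr _ (signature y b t) _ (show k + 1 + 0 = k + 1 by omega)).trans
        (tensorMulCast_one (signature x a b (k + 1)) _)).symm

end Signature

end

theorem mainTheorem3 {V : Type*} [NormedAddCommGroup V] [NormedSpace ℝ V]
    [FiniteDimensional ℝ V] {p a b c : ℝ} (hp1 : 1 ≤ p) (hp2 : p < 2)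
    (hab : a ≤ b) (hbc : b ≤ c) {x y : ℝ → V}
    (hx : x ∈ pVarPaths V p a b) (hy : y ∈ pVarPaths V p b c) :
    concatPath b x y ∈ pVarPaths V p a c ∧
    SignatureWellDefined x a b ∧ SignatureWellDefined y b c ∧
    SignatureWellDefined (concatPath b x y) a c ∧
    signature (concatPath b x y) a c = signature x a b * signature y b c := by
  have hz := concatPath_mem_pVarPaths hp1 hab hbc hx hy
  exact ⟨hz, signatureWellDefined_of_mem_pVarPaths hp1 hp2 hx,
    signatureWellDefined_of_mem_pVarPaths hp1 hp2 hy,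
    signatureWellDefined_of_mem_pVarPaths hp1 hp2 hz,
    funext fun k => signature_concatPath hp1 hp2 hab hx hy k ⟨hbc, le_rfl⟩⟩
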